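/- Let $\mathbb K$ be a field (for instance $\mathbb R$); vector spaces may be infinite-dimensional. **Data.** A (strict) Lie 2-algebra is given by a crossed module of Lie algebras: a Lie algebra morphism $\mu:\mathfrak g\to\mathfrak h$ with an action $\mathcal L$ of $\mathfrak h$ on $\mathfrak g$ by derivations such that $\mu(\mathcal L_yx)=[y,\mu(x)]$ and $\mathcal L_{\mu(x_0)}x_1=[x_0,x_1]$. A 2-vector space is a linear map $\phi:W\to V$. A 2-representation $\rho=(\rho_0^1,\rho_0^0,\rho_1)$ of $\mu$ on $\phi$ is a morphism of crossed modules into $\mathfrak{gl}(\phi)$, i.e. representations $\rho_0^1$ of $\mathfrak h$ on $W$ and $\rho_0^0$ of $\mathfrak h$ on $V$ and a linear map $\rho_1:\mathfrak g\to\mathrm{Hom}(V,W)$ with $\phi\rho_0^1(y)=\rho_0^0(y)\phi$, $\rho_1([x_0,x_1])=\rho_1(x_0)\phi\rho_1(x_1)-\rho_1(x_1)\phi\rho_1(x_0)$, $\rho_0^1(\mu(x))=\rho_1(x)\phi$, $\rho_0^0(\mu(x))=\phi\rho_1(x)$ and $\rho_1(\mathcal L_yx)=\rho_0^1(y)\rho_1(x)-\rho_1(x)\rho_0^0(y)$.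 **Extensions.** A 2-extension of $\mu$ by $\phi$ is a crossed module $\epsilon:\mathfrak e_1\to\mathfrak e_0$ with exact rows $0\to W\xrightarrow{j_1}\mathfrak e_1\xrightarrow{\pi_1}\mathfrak g\to0$ and $0\to V\xrightarrow{j_0}\mathfrak e_0\xrightarrow{\pi_0}\mathfrak h\to 0$ such that $j=(j_1,j_0)$ and $\pi=(\pi_1,\pi_0)$ are morphisms of crossed modules, where $W\to V$ carries zero brackets and zero action. Two 2-extensions are equivalent if there is an isomorphism of crossed modules between them that commutes with the maps $j$ and $\pi$. A 2-extension together with a linear splitting $\sigma=(\sigma_1,\sigma_0)$ of $\pi$ induces $\rho$ if (with $j$ read as inclusions) $\rho_0^0(y)v=[\sigma_0(y),v]$, $\rho_0^1(y)w=\mathcal L^\epsilon_{\sigma_0(y)}w$ and $\rho_1(x)v=-\mathcal L^\epsilon_v\sigma_1(x)$. **The complex.** Let $\mathfrak g_p\cong\mathfrak g^p\oplus\mathfrak h$ be the Lie algebra of strings $\xi=(x^0,\dots,x^{p-1};y)$ of $p$ composable arrows of the Lie 2-algebra ($\mathfrak g_0=\mathfrak h$), with face maps $$\partial_k\xi=\begin{cases}(x^1,\dots,x^{p-1};y)&k=0\\(x^0,\dots,x^{k-1}+x^k,\dots,x^{p-1};y)&0<k<p\\(x^0,\dots,x^{p-2};y+\mu(x^{p-1}))&k=p\end{cases}$$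 and final target $\hat t_p(\xi)=y+\sum_j\mu(x^j)$. Its bracket is computed arrow by arrow in the semidirect sum $\mathfrak g\oplus_{\mathcal L}\mathfrak h$, the $j$-th arrow of $\xi$ being $(x^j,\,y+\sum_{k>j}\mu(x^k))$. Let $C^{p,q}_0$ be the space of alternating $q$-linear maps $\mathfrak g_p^q\to V$, let $C^{p,q}_r$ for $r>0$ be the space of maps $\mathfrak g_p^q\times\mathfrak g^r\to W$ that are alternating and multilinear in each group of variables, and put $C^n=\bigoplus_{p+q+r=n}C^{p,q}_r$. On $C^{p,q}_r$ the differential is $$\nabla=\delta^{(r)}+(-1)^q\delta_{(1)}+(-1)^{q+r}\partial+(-1)^r\sum_{k\ge1}\Delta_k ,$$ where * $\delta^{(r)}$ is the Chevalley–Eilenberg differential of $\mathfrak g_p$ with values in $V$ ($r=0$), respectively in the alternating $r$-linear maps $\mathfrak g^r\to W$ ($r>0$), on which $\mathfrak g_p$ acts through $\hat t_p$ and the representation $\rho_0^0$ of $\mathfrak h$, respectively $(y\cdot\omega)(x_1,\dots,x_r)=\rho^1_0(y)\omega(x_1,\dots,x_r)-\sum_k\omega(x_1,\dots,\mathcal L_yx_k,\dots,x_r)$;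 * $\delta_{(1)}$ is given by $\delta_{(1)}\omega(\Xi;x)=\rho_1(x)\omega(\Xi)$ for $r=0$, and for $r>0$ it is the Chevalley–Eilenberg differential of $\mathfrak g$ in the last $r$ variables, with values in the representation $\rho_0^1\circ\mu$; * $\partial\omega(\Xi;Z)=\sum_{k=0}^{p+1}(-1)^k\omega(\partial_k\Xi;Z)$; * $\Delta_k:C^{p,q}_r\to C^{p+1,q+k}_{r-k}$ ($1\le k\le r$) is given, for $\Xi=(\xi_0,\dots,\xi_{q+k-1})$ and with $x_a^0$ the first entry of $\xi_a$, by $$\Delta_k\omega(\Xi;Z)=(-1)^{(k-1)q+\frac{k(k-1)}2}\sum_{a_1<\dots<a_k}(-1)^{a_1+\dots+a_k}\,\omega(\partial_0\Xi(a_1,\dots,a_k);x^0_{a_1},\dots,x^0_{a_k},Z),$$ where $\Xi(a_1,\dots,a_k)$ omits the entries $a_1,\dots,a_k$; if $k=r$, the right-hand side is composed with $\phi$. $H^2_\nabla(\mathfrak g_1,\phi)$ denotes the space of 2-cocycles $\{c\in C^2:\nabla c=0\}$ modulo the 2-coboundaries $\nabla(C^1)$. **Theorem.** Let $\mu:\mathfrak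 g\to\mathfrak h$ be a crossed module of Lie algebras and $\phi:W\to V$ a 2-vector space. 1. Every 2-extension of $\mu$ by $\phi$ induces exactly one 2-representation, and this does not depend on the linear splitting. 2. Let $\rho$ be a 2-representation of $\mu$ on $\phi$. Then every 2-coboundary is a 2-cocycle, and there is a bijection from the set of equivalence classes of 2-extensions of $\mu$ by $\phi$ inducing $\rho$ onto $H^2_\nabla(\mathfrak g_1,\phi)$. For every 2-extension $\mathfrak e$ inducing $\rho$ and every linear splitting $\sigma$ of it, this bijection sends the class of $\mathfrak e$ to the class of the 2-cocycle whose components are $$\omega_0(y_0,y_1)=\sigma_0([y_0,y_1])-[\sigma_0(y_0),\sigma_0(y_1)]\in V,\qquad \alpha(y;x)=\sigma_1(\mathcal L_yx)-\mathcal L^\epsilon_{\sigma_0(y)}\sigma_1(x)\in W,$$ $$\varphi(x,y)=\epsilon(\sigma_1(x))-\sigma_0(\mu(x))\in V,\qquad \omega_1(x_0,x_1)=\sigma_1([x_0,x_1])-[\sigma_1(x_0),\sigma_1(x_1)]\in W$$ in $C^{0,2}_0$, $C^{0,1}_1$, $C^{1,1}_0$ and $C^{0,0}_2$ respectively, and zero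 in $C^{1,0}_1$ and $C^{2,0}_0$. -/

import Mathlib

universe u v

namespace LieTwo

section Basic

/-- A crossed module of Lie algebras `mu : g → h`, i.e. a (strict) Lie 2-algebra. The action of `h`
on `g` is by derivations. -/
structure CrossedModule (𝕜 : Type v) [Field 𝕜] (g h : Type u) [LieRing g] [LieAlgebra 𝕜 g]
    [LieRing h] [LieAlgebra 𝕜 h] where
  mu : g →ₗ⁅𝕜⁆ h
  act : h →ₗ⁅𝕜⁆ LieDerivation 𝕜 g g
  equivariance : ∀ (y : h) (x : g), mu (act y x) = ⁅y, mu x⁆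
  peiffer : ∀ x₀ x₁ : g, act (mu x₀) x₁ = ⁅x₀, x₁⁆

variable {𝕜 : Type v} [Field 𝕜] {g h W V : Type u}
  [LieRing g] [LieAlgebra 𝕜 g] [LieRing h] [LieAlgebra 𝕜 h]
  [AddCommGroup W] [Module 𝕜 W] [AddCommGroup V] [Module 𝕜 V]

/-- A 2-representation of `mu : g → h` on the 2-vector space `phi : W → V`: a morphism of crossed
modules from `g → h` to the linear Lie 2-algebra `gl(phi)`, whose degree-zero part is
`{(F, f) ∈ gl(W) × gl(V) | phi ∘ F = f ∘ phi}`, whose degree-one part is `Hom(V, W)` with bracket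
`A ∘ phi ∘ B - B ∘ phi ∘ A`, whose structure map is `A ↦ (A ∘ phi, phi ∘ A)` and whose action is
`(F, f) · A = F ∘ A - A ∘ f`. -/
@[ext] structure TwoRep (M : CrossedModule 𝕜 g h) (phi : W →ₗ[𝕜] V) where
  /-- the representation of `h` on `W` -/
  onW : h →ₗ[𝕜] Module.End 𝕜 W
  /-- the representation of `h` on `V` -/
  onV : h →ₗ[𝕜] Module.End 𝕜 V
  /-- the degree-one component `g → Hom(V, W)` -/
  one : g →ₗ[𝕜] (V →ₗ[𝕜] W)
  onW_lie : ∀ (y₀ y₁ : h) (w : W),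
    onW ⁅y₀, y₁⁆ w = onW y₀ (onW y₁ w) - onW y₁ (onW y₀ w)
  onV_lie : ∀ (y₀ y₁ : h) (v : V),
    onV ⁅y₀, y₁⁆ v = onV y₀ (onV y₁ v) - onV y₁ (onV y₀ v)
  comm : ∀ (y : h) (w : W), phi (onW y w) = onV y (phi w)
  one_lie : ∀ (x₀ x₁ : g) (v : V),
    one ⁅x₀, x₁⁆ v = one x₀ (phi (one x₁ v)) - one x₁ (phi (one x₀ v))
  onW_mu : ∀ (x : g) (w : W), onW (M.mu x) w = one x (phi w)
  onV_mu : ∀ (x : g) (v : V), onV (M.mu x) v = phi (one x v)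
  one_act : ∀ (y : h) (x : g) (v : V), one (M.act y x) v = onW y (one x v) - one x (onV y v)

end Basic

/-! ### The nerve -/

section NerveSection

/-- The Lie algebra `g_p` of strings of `p` composable arrows of the Lie 2-algebra (`g_0 = h`). The
element `(x^0, …, x^{p-1}; y)` stands for the string whose `j`-th arrow is
`(x^j, y + ∑_{k > j} mu (x^k))` in the semidirect sum `g ⊕ h`, an arrow `(x, y)` having source `y`
and target `y + mu x`. -/
abbrev Nerve (g h : Type u) (p : ℕ) : Type u := (Fin p → g) × h

variable {𝕜 : Type v} [Field 𝕜] {g h : Type u}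
  [LieRing g] [LieAlgebra 𝕜 g] [LieRing h] [LieAlgebra 𝕜 h]

/-- The source of the `j`-th arrow of a string. -/
def sourceAt (M : CrossedModule 𝕜 g h) {p : ℕ} (ξ : Nerve g h p) (j : Fin p) : h :=
  ξ.2 + ∑ k ∈ Finset.Ioi j, M.mu (ξ.1 k)

/-- The Lie bracket of `g_p`: arrow by arrow, it is the bracket of the semidirect sum `g ⊕ h`. -/
def nerveBracket (M : CrossedModule 𝕜 g h) {p : ℕ} (ξ η : Nerve g h p) : Nerve g h p :=
  (fun j => ⁅ξ.1 j, η.1 j⁆ + M.act (sourceAt M ξ j) (η.1 j) - M.act (sourceAt M η j) (ξ.1 j),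
    ⁅ξ.2, η.2⁆)

/-- The final target map `g_p → h`. -/
def finalTarget (M : CrossedModule 𝕜 g h) {p : ℕ} (ξ : Nerve g h p) : h :=
  ξ.2 + ∑ j, M.mu (ξ.1 j)

/-- The face maps `∂_k : g_{p+1} → g_p`, for `k = 0, …, p+1`: drop the first arrow if `k = 0`,
compose the arrows `k-1` and `k` if `0 < k ≤ p`, drop the last arrow if `k = p+1`. -/
def face (M : CrossedModule 𝕜 g h) {p : ℕ} (k : Fin (p + 2)) (ξ : Nerve g h (p + 1)) :
    Nerve g h p :=
  (fun i =>
    if i.val + 1 < k.val then ξ.1 i.castSucc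
    else if i.val + 1 = k.val then ξ.1 i.castSucc + ξ.1 i.succ
    else ξ.1 i.succ,
   if k = Fin.last (p + 1) then ξ.2 + M.mu (ξ.1 (Fin.last p)) else ξ.2)

end NerveSection

/-! ### Building blocks of the differential -/

section Blocks

/-- `∑_{m<n} (-1)^{m+n} ω([x_m, x_n], X(m,n))`, where `X(m,n)` omits the entries `m` and `n`. -/
def ceBracketPart (𝕜 : Type v) [Field 𝕜] {A N : Type u} [AddCommGroup N] [Module 𝕜 N]
    (br : A → A → A) : (q : ℕ) → ((Fin q → A) → N) → (Fin (q + 1) → A) → N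
  | 0, _, _ => 0
  | q + 1, ω, X =>
    ∑ n : Fin (q + 2), ∑ m : Fin (q + 1),
      if m.castSucc < n then
        (-1 : 𝕜) ^ (m.val + n.val) •
          ω (Fin.cons (br (X m.castSucc) (X n)) (m.removeNth (n.removeNth X)))
      else 0

/-- The Chevalley–Eilenberg differential
`∑_j (-1)^j x_j · ω(X(j)) + ∑_{m<n} (-1)^{m+n} ω([x_m, x_n], X(m,n))`. -/
def ceDiff (𝕜 : Type v) [Field 𝕜] {A N : Type u} [AddCommGroup N] [Module 𝕜 N]
    (br : A → A → A) (rep : A → N →ₗ[𝕜] N) (q : ℕ) (ω : (Fin q → A) → N)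
    (X : Fin (q + 1) → A) : N :=
  (∑ j : Fin (q + 1), (-1 : 𝕜) ^ j.val • rep (X j) (ω (j.removeNth X))) +
    ceBracketPart 𝕜 br q ω X

variable {𝕜 : Type v} [Field 𝕜] {g h W V : Type u}
  [LieRing g] [LieAlgebra 𝕜 g] [LieRing h] [LieAlgebra 𝕜 h]
  [AddCommGroup W] [Module 𝕜 W] [AddCommGroup V] [Module 𝕜 V]

/-- The representation of `h` on `⋀^r g^* ⊗ W`:
`(y · ω)(x_1, …, x_r) = y · ω(x_1, …, x_r) - ∑_k ω(x_1, …, y · x_k, …, x_r)`. -/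
def repR (M : CrossedModule 𝕜 g h) {phi : W →ₗ[𝕜] V} (ρ : TwoRep M phi) (r : ℕ) (y : h) :
    ((Fin r → g) → W) →ₗ[𝕜] ((Fin r → g) → W) where
  toFun ω X := ρ.onW y (ω X) - ∑ k : Fin r, ω (Function.update X k (M.act y (X k)))
  map_add' ω η := by
    funext X
    simp only [Pi.add_apply, map_add, Finset.sum_add_distrib]
    abel
  map_smul' a ω := by
    funext X
    simp only [Pi.smul_apply, map_smul, RingHom.id_apply, smul_sub, Finset.smul_sum]

/-- The groupoid differential `∑_k (-1)^k ω(∂_k Ξ)`. -/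
def simplicialDiff {N : Type u} [AddCommGroup N] [Module 𝕜 N] (M : CrossedModule 𝕜 g h)
    (p q : ℕ) (ω : (Fin q → Nerve g h p) → N) (Ξ : Fin q → Nerve g h (p + 1)) : N :=
  ∑ k : Fin (p + 2), (-1 : 𝕜) ^ k.val • ω (fun i => face M k (Ξ i))

theorem card_compl_of_card {q k : ℕ} (A : {A : Finset (Fin (q + k)) // A.card = k}) :
    (A.1ᶜ).card = q := by
  rw [Finset.card_compl, A.2, Fintype.card_fin, Nat.add_sub_cancel]

/-- The `k`-th difference map
`(Δ_k ω)(Ξ) = ε ∑_{a_1 < … < a_k} (-1)^{a_1 + … + a_k}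
  ω(∂_0 Ξ(a_1, …, a_k); x_{a_1}^0, …, x_{a_k}^0)`, with `ε = (-1)^{(k-1) q + k (k-1) / 2}`.
Here `x_a^0` is the first entry of `ξ_a`, and `Ξ(a_1, …, a_k)` omits the entries `a_1, …, a_k`. -/
def differenceMap {N : Type u} [AddCommGroup N] [Module 𝕜 N] (M : CrossedModule 𝕜 g h)
    (p q k : ℕ) (ω : (Fin q → Nerve g h p) → (Fin k → g) → N)
    (Ξ : Fin (q + k) → Nerve g h (p + 1)) : N :=
  (-1 : 𝕜) ^ ((k - 1) * q + k * (k - 1) / 2) •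
    ∑ A : {A : Finset (Fin (q + k)) // A.card = k},
      (-1 : 𝕜) ^ (∑ a ∈ A.1, a.val) •
        ω (fun i => face M 0 (Ξ ((A.1ᶜ).orderEmbOfFin (card_compl_of_card A) i)))
          (fun i => (Ξ (A.1.orderEmbOfFin A.2 i)).1 0)

end Blocks

/-! ### Cochains, the differential, cohomology -/

section Cochains

/-- Families of functions containing the cochains of all degrees. For `c : PreCochain g h W V`,
`c.1 p q` is the component in tridegree `(p, q, 0)`, with values in `V`, and `c.2 p q r` is the
component in tridegree `(p, q, r + 1)`, with values in `W`. -/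
abbrev PreCochain (g h W V : Type u) : Type u :=
  ((p q : ℕ) → (Fin q → Nerve g h p) → V) ×
    ((p q r : ℕ) → (Fin q → Nerve g h p) → (Fin (r + 1) → g) → W)

/-- `f` is an alternating multilinear function of `q` arguments. -/
def IsAlternating (𝕜 : Type v) [Field 𝕜] {A N : Type u} [AddCommGroup A] [Module 𝕜 A]
    [AddCommGroup N] [Module 𝕜 N] {q : ℕ} (f : (Fin q → A) → N) : Prop :=
  ∃ F : A [⋀^Fin q]→ₗ[𝕜] N, ⇑F = f

variable {𝕜 : Type v} [Field 𝕜] {g h W V : Type u}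
  [LieRing g] [LieAlgebra 𝕜 g] [LieRing h] [LieAlgebra 𝕜 h]
  [AddCommGroup W] [Module 𝕜 W] [AddCommGroup V] [Module 𝕜 V]

variable (𝕜 g h W V) in
/-- The space of `n`-cochains, `⨁_{p+q+r=n} C^{p,q}_r`, with `C^{p,q}_0 = ⋀^q g_p^* ⊗ V` and
`C^{p,q}_r = ⋀^q g_p^* ⊗ ⋀^r g^* ⊗ W` for `r > 0`, as spaces of alternating multilinear maps. -/
def Cochain (n : ℕ) : Submodule 𝕜 (PreCochain g h W V) where
  carrier := {c |
    (∀ p q, IsAlternating 𝕜 (c.1 p q)) ∧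
    (∀ p q r, (∀ Z, IsAlternating 𝕜 (fun Ξ => c.2 p q r Ξ Z)) ∧
      ∀ Ξ, IsAlternating 𝕜 (c.2 p q r Ξ)) ∧
    (∀ p q, p + q ≠ n → c.1 p q = 0) ∧
    (∀ p q r, p + q + (r + 1) ≠ n → c.2 p q r = 0)}
  add_mem' := by
    rintro c d ⟨h1, h2, h3, h4⟩ ⟨k1, k2, k3, k4⟩
    refine ⟨fun p q => ?_, fun p q r => ⟨fun Z => ?_, fun Ξ => ?_⟩, fun p q hn => ?_,
      fun p q r hn => ?_⟩
    · obtain ⟨F, hF⟩ := h1 p q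
      obtain ⟨G, hG⟩ := k1 p q
      exact ⟨F + G, by funext x; exact congrArg₂ (· + ·) (congrFun hF x) (congrFun hG x)⟩
    · obtain ⟨F, hF⟩ := (h2 p q r).1 Z
      obtain ⟨G, hG⟩ := (k2 p q r).1 Z
      exact ⟨F + G, by funext x; exact congrArg₂ (· + ·) (congrFun hF x) (congrFun hG x)⟩
    · obtain ⟨F, hF⟩ := (h2 p q r).2 Ξ
      obtain ⟨G, hG⟩ := (k2 p q r).2 Ξ
      exact ⟨F + G, by funext x; exact congrArg₂ (· + ·) (congrFun hF x) (congrFun hG x)⟩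
    · simp [h3 p q hn, k3 p q hn]
    · simp [h4 p q r hn, k4 p q r hn]
  zero_mem' :=
    ⟨fun _ _ => ⟨0, rfl⟩, fun _ _ _ => ⟨fun _ => ⟨0, rfl⟩, fun _ => ⟨0, rfl⟩⟩,
      fun _ _ _ => rfl, fun _ _ _ _ => rfl⟩
  smul_mem' := by
    rintro a c ⟨h1, h2, h3, h4⟩
    refine ⟨fun p q => ?_, fun p q r => ⟨fun Z => ?_, fun Ξ => ?_⟩, fun p q hn => ?_,
      fun p q r hn => ?_⟩
    · obtain ⟨F, hF⟩ := h1 p q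
      exact ⟨a • F, by funext x; exact congrArg (a • ·) (congrFun hF x)⟩
    · obtain ⟨F, hF⟩ := (h2 p q r).1 Z
      exact ⟨a • F, by funext x; exact congrArg (a • ·) (congrFun hF x)⟩
    · obtain ⟨F, hF⟩ := (h2 p q r).2 Ξ
      exact ⟨a • F, by funext x; exact congrArg (a • ·) (congrFun hF x)⟩
    · simp [h3 p q hn]
    · simp [h4 p q r hn]

variable {M : CrossedModule 𝕜 g h} {phi : W →ₗ[𝕜] V}

/-- `δ`, component of target tridegree `(p, q, 0)`. -/
def deltaV (ρ : TwoRep M phi) (c : PreCochain g h W V) (p : ℕ) :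
    (q : ℕ) → (Fin q → Nerve g h p) → V
  | 0, _ => 0
  | q + 1, Ξ => ceDiff 𝕜 (nerveBracket M) (fun ξ => ρ.onV (finalTarget M ξ)) q (c.1 p q) Ξ

/-- `δ^{(r+1)}`, component of target tridegree `(p, q, r + 1)`. -/
def deltaW (ρ : TwoRep M phi) (c : PreCochain g h W V) (p : ℕ) :
    (q r : ℕ) → (Fin q → Nerve g h p) → (Fin (r + 1) → g) → W
  | 0, _, _, _ => 0
  | q + 1, r, Ξ, Z =>
    ceDiff 𝕜 (nerveBracket M) (fun ξ => repR M ρ (r + 1) (finalTarget M ξ)) q (c.2 p q r) Ξ Z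

/-- `δ_{(1)}`, component of target tridegree `(p, q, r + 1)`. -/
def deltaOne (ρ : TwoRep M phi) (c : PreCochain g h W V) (p q : ℕ) :
    (r : ℕ) → (Fin q → Nerve g h p) → (Fin (r + 1) → g) → W
  | 0, Ξ, Z => ρ.one (Z 0) (c.1 p q Ξ)
  | r + 1, Ξ, Z =>
    ceDiff 𝕜 (fun x₀ x₁ : g => ⁅x₀, x₁⁆) (fun x => ρ.onW (M.mu x)) (r + 1) (c.2 p q r Ξ) Z

/-- `(-1)^{q+r} ∂ + (-1)^r ∑_{k ≥ 1} Δ_k`, component of target tridegree `(p, q, 0)`; here `(q, r)`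
belongs to the source. The summand of index `k` is the one of `Δ_{k+1}`. -/
def horizontalV (M : CrossedModule 𝕜 g h) (phi : W →ₗ[𝕜] V) (c : PreCochain g h W V) :
    (p q : ℕ) → (Fin q → Nerve g h p) → V
  | 0, _, _ => 0
  | p + 1, q, Ξ =>
    (-1 : 𝕜) ^ q • simplicialDiff M p q (c.1 p q) Ξ +
    ∑ k : Fin q, (-1 : 𝕜) ^ (k.val + 1) •
      differenceMap M p (q - (k.val + 1)) (k.val + 1)
        (fun Ξ' X => phi (c.2 p (q - (k.val + 1)) k.val Ξ' X))
        (fun i => Ξ (Fin.cast (Nat.sub_add_cancel k.isLt) i))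

/-- `(-1)^{q+r'} ∂ + (-1)^{r'} ∑_{k ≥ 1} Δ_k`, component of target tridegree `(p, q, r + 1)`; here
`r'` belongs to the source. The summand of index `k` is the one of `Δ_{k+1}`. -/
def horizontalW (M : CrossedModule 𝕜 g h) (c : PreCochain g h W V) :
    (p q r : ℕ) → (Fin q → Nerve g h p) → (Fin (r + 1) → g) → W
  | 0, _, _, _, _ => 0
  | p + 1, q, r, Ξ, Z =>
    (-1 : 𝕜) ^ (q + (r + 1)) • simplicialDiff M p q (fun Ξ' => c.2 p q r Ξ' Z) Ξ +
    ∑ k : Fin q, (-1 : 𝕜) ^ (r + 1 + (k.val + 1)) •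
      differenceMap M p (q - (k.val + 1)) (k.val + 1)
        (fun Ξ' X => c.2 p (q - (k.val + 1)) (k.val + 1 + r) Ξ'
          (Fin.append X Z : Fin (k.val + 1 + (r + 1)) → g))
        (fun i => Ξ (Fin.cast (Nat.sub_add_cancel k.isLt) i))

/-- The underlying function of the differential
`∇ = δ^{(r)} + (-1)^q δ_{(1)} + (-1)^{q+r} ∂ + (-1)^r ∑_{k ≥ 1} Δ_k`. -/
def nablaFun (ρ : TwoRep M phi) (c : PreCochain g h W V) : PreCochain g h W V :=
  (fun p q Ξ => deltaV ρ c p q Ξ + horizontalV M phi c p q Ξ,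
   fun p q r Ξ Z => deltaW ρ c p q r Ξ Z + (-1 : 𝕜) ^ q • deltaOne ρ c p q r Ξ Z +
      horizontalW M c p q r Ξ Z)

theorem ceDiff_add {A N : Type u} [AddCommGroup N] [Module 𝕜 N] (br : A → A → A)
    (rep : A → N →ₗ[𝕜] N) (q : ℕ) (ω η : (Fin q → A) → N) (X : Fin (q + 1) → A) :
    ceDiff 𝕜 br rep q (ω + η) X = ceDiff 𝕜 br rep q ω X + ceDiff 𝕜 br rep q η X := by
  have hb : ceBracketPart 𝕜 br q (ω + η) X =
      ceBracketPart 𝕜 br q ω X + ceBracketPart 𝕜 br q η X := by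
    cases q with
    | zero => simp [ceBracketPart]
    | succ q =>
      simp only [ceBracketPart, Pi.add_apply, ← Finset.sum_add_distrib]
      refine Finset.sum_congr rfl fun n _ => Finset.sum_congr rfl fun m _ => ?_
      split_ifs <;> simp
  simp only [ceDiff, hb, Pi.add_apply, map_add, smul_add, Finset.sum_add_distrib]
  abel

theorem ceDiff_smul {A N : Type u} [AddCommGroup N] [Module 𝕜 N] (br : A → A → A)
    (rep : A → N →ₗ[𝕜] N) (q : ℕ) (a : 𝕜) (ω : (Fin q → A) → N) (X : Fin (q + 1) → A) :
    ceDiff 𝕜 br rep q (a • ω) X = a • ceDiff 𝕜 br rep q ω X := by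
  have hb : ceBracketPart 𝕜 br q (a • ω) X = a • ceBracketPart 𝕜 br q ω X := by
    cases q with
    | zero => simp [ceBracketPart]
    | succ q =>
      simp only [ceBracketPart, Pi.smul_apply, Finset.smul_sum]
      refine Finset.sum_congr rfl fun n _ => Finset.sum_congr rfl fun m _ => ?_
      split_ifs
      · rw [smul_comm]
      · simp
  simp only [ceDiff, hb, Pi.smul_apply, map_smul, smul_add, Finset.smul_sum]
  congr 1
  exact Finset.sum_congr rfl fun j _ => smul_comm _ _ _

theorem simplicialDiff_add {N : Type u} [AddCommGroup N] [Module 𝕜 N] (M : CrossedModule 𝕜 g h)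
    (p q : ℕ) (ω η : (Fin q → Nerve g h p) → N) (Ξ : Fin q → Nerve g h (p + 1)) :
    simplicialDiff M p q (ω + η) Ξ = simplicialDiff M p q ω Ξ + simplicialDiff M p q η Ξ := by
  simp [simplicialDiff, Finset.sum_add_distrib]

theorem simplicialDiff_smul {N : Type u} [AddCommGroup N] [Module 𝕜 N] (M : CrossedModule 𝕜 g h)
    (p q : ℕ) (a : 𝕜) (ω : (Fin q → Nerve g h p) → N) (Ξ : Fin q → Nerve g h (p + 1)) :
    simplicialDiff M p q (a • ω) Ξ = a • simplicialDiff M p q ω Ξ := by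
  simp only [simplicialDiff, Pi.smul_apply, Finset.smul_sum]
  exact Finset.sum_congr rfl fun j _ => smul_comm _ _ _

theorem differenceMap_add {N : Type u} [AddCommGroup N] [Module 𝕜 N] (M : CrossedModule 𝕜 g h)
    (p q k : ℕ) (ω η : (Fin q → Nerve g h p) → (Fin k → g) → N)
    (Ξ : Fin (q + k) → Nerve g h (p + 1)) :
    differenceMap M p q k (ω + η) Ξ =
      differenceMap M p q k ω Ξ + differenceMap M p q k η Ξ := by
  simp [differenceMap, Finset.sum_add_distrib]

theorem differenceMap_smul {N : Type u} [AddCommGroup N] [Module 𝕜 N] (M : CrossedModule 𝕜 g h)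
    (p q k : ℕ) (a : 𝕜) (ω : (Fin q → Nerve g h p) → (Fin k → g) → N)
    (Ξ : Fin (q + k) → Nerve g h (p + 1)) :
    differenceMap M p q k (a • ω) Ξ = a • differenceMap M p q k ω Ξ := by
  simp only [differenceMap, Pi.smul_apply]
  rw [smul_comm a, Finset.smul_sum (r := a)]
  congr 1
  exact Finset.sum_congr rfl fun j _ => smul_comm _ _ _

theorem deltaV_add (ρ : TwoRep M phi) (c d : PreCochain g h W V) (p q : ℕ)
    (Ξ : Fin q → Nerve g h p) :
    deltaV ρ (c + d) p q Ξ = deltaV ρ c p q Ξ + deltaV ρ d p q Ξ := by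
  cases q with
  | zero => simp [deltaV]
  | succ q =>
    exact ceDiff_add (𝕜 := 𝕜) (nerveBracket M)
      (fun ξ => ρ.onV (finalTarget M ξ)) q (c.1 p q) (d.1 p q) Ξ

theorem deltaV_smul (ρ : TwoRep M phi) (a : 𝕜) (c : PreCochain g h W V) (p q : ℕ)
    (Ξ : Fin q → Nerve g h p) : deltaV ρ (a • c) p q Ξ = a • deltaV ρ c p q Ξ := by
  cases q with
  | zero => simp [deltaV]
  | succ q =>
    exact ceDiff_smul (𝕜 := 𝕜) (nerveBracket M)
      (fun ξ => ρ.onV (finalTarget M ξ)) q a (c.1 p q) Ξ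

theorem deltaW_add (ρ : TwoRep M phi) (c d : PreCochain g h W V) (p q r : ℕ)
    (Ξ : Fin q → Nerve g h p) (Z : Fin (r + 1) → g) :
    deltaW ρ (c + d) p q r Ξ Z = deltaW ρ c p q r Ξ Z + deltaW ρ d p q r Ξ Z := by
  cases q with
  | zero => simp [deltaW]
  | succ q =>
    exact congrFun (ceDiff_add (𝕜 := 𝕜) (nerveBracket M)
      (fun ξ => repR M ρ (r + 1) (finalTarget M ξ)) q (c.2 p q r) (d.2 p q r) Ξ) Z

theorem deltaW_smul (ρ : TwoRep M phi) (a : 𝕜) (c : PreCochain g h W V) (p q r : ℕ)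
    (Ξ : Fin q → Nerve g h p) (Z : Fin (r + 1) → g) :
    deltaW ρ (a • c) p q r Ξ Z = a • deltaW ρ c p q r Ξ Z := by
  cases q with
  | zero => simp [deltaW]
  | succ q =>
    exact congrFun (ceDiff_smul (𝕜 := 𝕜) (nerveBracket M)
      (fun ξ => repR M ρ (r + 1) (finalTarget M ξ)) q a (c.2 p q r) Ξ) Z

theorem deltaOne_add (ρ : TwoRep M phi) (c d : PreCochain g h W V) (p q r : ℕ)
    (Ξ : Fin q → Nerve g h p) (Z : Fin (r + 1) → g) :
    deltaOne ρ (c + d) p q r Ξ Z = deltaOne ρ c p q r Ξ Z + deltaOne ρ d p q r Ξ Z := by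
  cases r with
  | zero => simp [deltaOne]
  | succ r =>
    exact ceDiff_add (𝕜 := 𝕜) (fun x₀ x₁ : g => ⁅x₀, x₁⁆)
      (fun x => ρ.onW (M.mu x)) (r + 1) (c.2 p q r Ξ) (d.2 p q r Ξ) Z

theorem deltaOne_smul (ρ : TwoRep M phi) (a : 𝕜) (c : PreCochain g h W V) (p q r : ℕ)
    (Ξ : Fin q → Nerve g h p) (Z : Fin (r + 1) → g) :
    deltaOne ρ (a • c) p q r Ξ Z = a • deltaOne ρ c p q r Ξ Z := by
  cases r with
  | zero => simp [deltaOne]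
  | succ r =>
    exact ceDiff_smul (𝕜 := 𝕜) (fun x₀ x₁ : g => ⁅x₀, x₁⁆)
      (fun x => ρ.onW (M.mu x)) (r + 1) a (c.2 p q r Ξ) Z

theorem horizontalV_add (c d : PreCochain g h W V) (p q : ℕ) (Ξ : Fin q → Nerve g h p) :
    horizontalV M phi (c + d) p q Ξ = horizontalV M phi c p q Ξ + horizontalV M phi d p q Ξ := by
  cases p with
  | zero => simp [horizontalV]
  | succ p =>
    have h1 := simplicialDiff_add M p q (c.1 p q) (d.1 p q) Ξ
    have h2 : ∀ k : Fin q, differenceMap M p (q - (k.val + 1)) (k.val + 1)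
        (fun Ξ' X => phi ((c + d).2 p (q - (k.val + 1)) k.val Ξ' X))
        (fun i => Ξ (Fin.cast (Nat.sub_add_cancel k.isLt) i)) = _ := fun k =>
      (congrArg (fun ω => differenceMap M p (q - (k.val + 1)) (k.val + 1) ω
        (fun i => Ξ (Fin.cast (Nat.sub_add_cancel k.isLt) i)))
        (by funext Ξ' X; exact map_add phi _ _)).trans
      (differenceMap_add M p (q - (k.val + 1)) (k.val + 1)
        (fun Ξ' X => phi (c.2 p (q - (k.val + 1)) k.val Ξ' X))
        (fun Ξ' X => phi (d.2 p (q - (k.val + 1)) k.val Ξ' X)) _)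
    simp only [horizontalV, h2, smul_add, Finset.sum_add_distrib]
    rw [show (c + d).1 p q = c.1 p q + d.1 p q from rfl, h1, smul_add]
    abel

theorem horizontalV_smul (a : 𝕜) (c : PreCochain g h W V) (p q : ℕ) (Ξ : Fin q → Nerve g h p) :
    horizontalV M phi (a • c) p q Ξ = a • horizontalV M phi c p q Ξ := by
  cases p with
  | zero => simp [horizontalV]
  | succ p =>
    have h1 := simplicialDiff_smul M p q a (c.1 p q) Ξ
    have h2 : ∀ k : Fin q, differenceMap M p (q - (k.val + 1)) (k.val + 1)
        (fun Ξ' X => phi ((a • c).2 p (q - (k.val + 1)) k.val Ξ' X))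
        (fun i => Ξ (Fin.cast (Nat.sub_add_cancel k.isLt) i)) = _ := fun k =>
      (congrArg (fun ω => differenceMap M p (q - (k.val + 1)) (k.val + 1) ω
        (fun i => Ξ (Fin.cast (Nat.sub_add_cancel k.isLt) i)))
        (by funext Ξ' X; exact map_smul phi _ _)).trans
      (differenceMap_smul M p (q - (k.val + 1)) (k.val + 1) a
        (fun Ξ' X => phi (c.2 p (q - (k.val + 1)) k.val Ξ' X)) _)
    simp only [horizontalV, h2]
    rw [show (a • c).1 p q = a • c.1 p q from rfl, h1, smul_add, smul_comm a, Finset.smul_sum]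
    congr 1
    exact Finset.sum_congr rfl fun k _ => smul_comm _ _ _

theorem horizontalW_add (c d : PreCochain g h W V) (p q r : ℕ) (Ξ : Fin q → Nerve g h p)
    (Z : Fin (r + 1) → g) :
    horizontalW M (c + d) p q r Ξ Z = horizontalW M c p q r Ξ Z + horizontalW M d p q r Ξ Z := by
  cases p with
  | zero => simp [horizontalW]
  | succ p =>
    have h1 := simplicialDiff_add M p q (fun Ξ' => c.2 p q r Ξ' Z) (fun Ξ' => d.2 p q r Ξ' Z) Ξ
    have h2 : ∀ k : Fin q, differenceMap M p (q - (k.val + 1)) (k.val + 1)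
        (fun Ξ' X => (c + d).2 p (q - (k.val + 1)) (k.val + 1 + r) Ξ'
          (Fin.append X Z : Fin (k.val + 1 + (r + 1)) → g))
        (fun i => Ξ (Fin.cast (Nat.sub_add_cancel k.isLt) i)) = _ := fun k =>
      differenceMap_add M p (q - (k.val + 1)) (k.val + 1)
        (fun Ξ' X => c.2 p (q - (k.val + 1)) (k.val + 1 + r) Ξ'
          (Fin.append X Z : Fin (k.val + 1 + (r + 1)) → g))
        (fun Ξ' X => d.2 p (q - (k.val + 1)) (k.val + 1 + r) Ξ'
          (Fin.append X Z : Fin (k.val + 1 + (r + 1)) → g)) _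
    simp only [horizontalW, h2, smul_add, Finset.sum_add_distrib]
    rw [show (fun Ξ' => (c + d).2 p q r Ξ' Z) =
      (fun Ξ' => c.2 p q r Ξ' Z) + (fun Ξ' => d.2 p q r Ξ' Z) from rfl, h1, smul_add]
    abel

theorem horizontalW_smul (a : 𝕜) (c : PreCochain g h W V) (p q r : ℕ) (Ξ : Fin q → Nerve g h p)
    (Z : Fin (r + 1) → g) :
    horizontalW M (a • c) p q r Ξ Z = a • horizontalW M c p q r Ξ Z := by
  cases p with
  | zero => simp [horizontalW]
  | succ p =>
    have h1 := simplicialDiff_smul M p q a (fun Ξ' => c.2 p q r Ξ' Z) Ξ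
    have h2 : ∀ k : Fin q, differenceMap M p (q - (k.val + 1)) (k.val + 1)
        (fun Ξ' X => (a • c).2 p (q - (k.val + 1)) (k.val + 1 + r) Ξ'
          (Fin.append X Z : Fin (k.val + 1 + (r + 1)) → g))
        (fun i => Ξ (Fin.cast (Nat.sub_add_cancel k.isLt) i)) = _ := fun k =>
      differenceMap_smul M p (q - (k.val + 1)) (k.val + 1) a
        (fun Ξ' X => c.2 p (q - (k.val + 1)) (k.val + 1 + r) Ξ'
          (Fin.append X Z : Fin (k.val + 1 + (r + 1)) → g)) _
    simp only [horizontalW, h2]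
    rw [show (fun Ξ' => (a • c).2 p q r Ξ' Z) = a • (fun Ξ' => c.2 p q r Ξ' Z) from rfl, h1,
      smul_add, smul_comm a, Finset.smul_sum]
    congr 1
    exact Finset.sum_congr rfl fun k _ => smul_comm _ _ _

/-- The differential `∇` of the complex of Lie 2-algebra cochains with values in `ρ`. -/
def nabla (ρ : TwoRep M phi) : PreCochain g h W V →ₗ[𝕜] PreCochain g h W V where
  toFun := nablaFun ρ
  map_add' c d := by
    refine Prod.ext ?_ ?_
    · funext p q Ξ
      simp only [nablaFun, deltaV_add, horizontalV_add, Prod.fst_add, Pi.add_apply]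
      abel
    · funext p q r Ξ Z
      simp only [nablaFun, deltaW_add, deltaOne_add, horizontalW_add, Prod.snd_add, Pi.add_apply,
        smul_add]
      abel
  map_smul' a c := by
    refine Prod.ext ?_ ?_
    · funext p q Ξ
      simp only [nablaFun, deltaV_smul, horizontalV_smul, Prod.smul_fst, Pi.smul_apply, smul_add,
        RingHom.id_apply]
    · funext p q r Ξ Z
      simp only [nablaFun, deltaW_smul, deltaOne_smul, horizontalW_smul, Prod.smul_snd,
        Pi.smul_apply, smul_add, RingHom.id_apply, smul_comm a]

/-- The space of `n`-cocycles. -/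
def cocycles (ρ : TwoRep M phi) (n : ℕ) : Submodule 𝕜 (PreCochain g h W V) :=
  Cochain 𝕜 g h W V n ⊓ LinearMap.ker (nabla ρ)

/-- The space of `n`-coboundaries. -/
def coboundaries (ρ : TwoRep M phi) : ℕ → Submodule 𝕜 (PreCochain g h W V)
  | 0 => ⊥
  | n + 1 => (Cochain 𝕜 g h W V n).map (nabla ρ)

/-- The cohomology `H^n_∇`: cocycles modulo coboundaries. -/
abbrev Cohomology (ρ : TwoRep M phi) (n : ℕ) : Type u :=
  ↥(cocycles ρ n) ⧸ (coboundaries ρ n).submoduleOf (cocycles ρ n)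

end Cochains

/-! ### Extensions -/

section Extensions

/-- An extension of the crossed module `g → h` by the 2-vector space `phi : W → V`: a crossed module
`e₁ → e₀` with short exact rows `0 → W → e₁ → g → 0` and `0 → V → e₀ → h → 0` forming maps of
crossed modules, where `W → V` is regarded as an abelian Lie 2-algebra (zero brackets and zero
action). -/
structure Extension {𝕜 : Type v} [Field 𝕜] {g h W V : Type u}
    [LieRing g] [LieAlgebra 𝕜 g] [LieRing h] [LieAlgebra 𝕜 h]
    [AddCommGroup W] [Module 𝕜 W] [AddCommGroup V] [Module 𝕜 V]
    (M : CrossedModule 𝕜 g h) (phi : W →ₗ[𝕜] V) where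
  e₁ : Type u
  e₀ : Type u
  [lieRing₁ : LieRing e₁]
  [lieAlgebra₁ : LieAlgebra 𝕜 e₁]
  [lieRing₀ : LieRing e₀]
  [lieAlgebra₀ : LieAlgebra 𝕜 e₀]
  eps : CrossedModule 𝕜 e₁ e₀
  j₁ : W →ₗ[𝕜] e₁
  j₀ : V →ₗ[𝕜] e₀
  π₁ : e₁ →ₗ⁅𝕜⁆ g
  π₀ : e₀ →ₗ⁅𝕜⁆ h
  j₁_injective : Function.Injective j₁
  j₀_injective : Function.Injective j₀
  exact₁ : Function.Exact j₁ π₁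
  exact₀ : Function.Exact j₀ π₀
  π₁_surjective : Function.Surjective π₁
  π₀_surjective : Function.Surjective π₀
  j₁_lie : ∀ w w' : W, ⁅j₁ w, j₁ w'⁆ = 0
  j₀_lie : ∀ v v' : V, ⁅j₀ v, j₀ v'⁆ = 0
  eps_j₁ : ∀ w : W, eps.mu (j₁ w) = j₀ (phi w)
  act_j : ∀ (v : V) (w : W), eps.act (j₀ v) (j₁ w) = 0
  π₀_eps : ∀ e : e₁, π₀ (eps.mu e) = M.mu (π₁ e)
  π₁_act : ∀ (f : e₀) (e : e₁), π₁ (eps.act f e) = M.act (π₀ f) (π₁ e)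

attribute [instance] Extension.lieRing₁ Extension.lieAlgebra₁ Extension.lieRing₀
  Extension.lieAlgebra₀

variable {𝕜 : Type v} [Field 𝕜] {g h W V : Type u}
  [LieRing g] [LieAlgebra 𝕜 g] [LieRing h] [LieAlgebra 𝕜 h]
  [AddCommGroup W] [Module 𝕜 W] [AddCommGroup V] [Module 𝕜 V]
  {M : CrossedModule 𝕜 g h} {phi : W →ₗ[𝕜] V}

/-- A linear splitting of an extension. -/
structure Extension.Splitting (E : Extension M phi) where
  σ₁ : g →ₗ[𝕜] E.e₁
  σ₀ : h →ₗ[𝕜] E.e₀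
  π₁_σ₁ : ∀ x, E.π₁ (σ₁ x) = x
  π₀_σ₀ : ∀ y, E.π₀ (σ₀ y) = y

/-- `ρ` is the 2-representation induced by the extension `E` and the linear splitting `σ`. -/
def Extension.InducesAlong (E : Extension M phi) (σ : E.Splitting) (ρ : TwoRep M phi) : Prop :=
  (∀ (y : h) (v : V), E.j₀ (ρ.onV y v) = ⁅σ.σ₀ y, E.j₀ v⁆) ∧
  (∀ (y : h) (w : W), E.j₁ (ρ.onW y w) = E.eps.act (σ.σ₀ y) (E.j₁ w)) ∧
  (∀ (x : g) (v : V), E.j₁ (ρ.one x v) = -E.eps.act (E.j₀ v) (σ.σ₁ x))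

/-- `E` induces `ρ` along some linear splitting. -/
def Extension.Induces (E : Extension M phi) (ρ : TwoRep M phi) : Prop :=
  ∃ σ : E.Splitting, E.InducesAlong σ ρ

/-- Equivalence of extensions: an isomorphism of crossed modules which is the identity on `W → V`
and on `g → h`. -/
def Extension.Equivalent (E F : Extension M phi) : Prop :=
  ∃ (ψ₁ : E.e₁ ≃ₗ⁅𝕜⁆ F.e₁) (ψ₀ : E.e₀ ≃ₗ⁅𝕜⁆ F.e₀),
    (∀ e, ψ₀ (E.eps.mu e) = F.eps.mu (ψ₁ e)) ∧
    (∀ f e, ψ₁ (E.eps.act f e) = F.eps.act (ψ₀ f) (ψ₁ e)) ∧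
    (∀ w, ψ₁ (E.j₁ w) = F.j₁ w) ∧ (∀ v, ψ₀ (E.j₀ v) = F.j₀ v) ∧
    (∀ e, F.π₁ (ψ₁ e) = E.π₁ e) ∧ (∀ f, F.π₀ (ψ₀ f) = E.π₀ f)

/-- Equivalence of extensions that induce `ρ`. -/
def extensionSetoid (ρ : TwoRep M phi) : Setoid {E : Extension M phi // E.Induces ρ} where
  r E F := E.1.Equivalent F.1
  iseqv :=
    { refl := fun E => ⟨LieEquiv.refl, LieEquiv.refl, fun _ => rfl, fun _ _ => rfl, fun _ => rfl,
        fun _ => rfl, fun _ => rfl, fun _ => rfl⟩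
      symm := by
        rintro E F ⟨ψ₁, ψ₀, h1, h2, h3, h4, h5, h6⟩
        refine ⟨ψ₁.symm, ψ₀.symm, fun e => ?_, fun f e => ?_, fun w => ?_, fun v => ?_,
          fun e => ?_, fun f => ?_⟩
        · apply ψ₀.injective
          change ψ₀ (ψ₀.symm _) = ψ₀ _
          rw [h1, LieEquiv.apply_symm_apply, LieEquiv.apply_symm_apply]
        · apply ψ₁.injective
          change ψ₁ (ψ₁.symm _) = ψ₁ _
          rw [h2, LieEquiv.apply_symm_apply, LieEquiv.apply_symm_apply, LieEquiv.apply_symm_apply]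
        · rw [← h3, LieEquiv.symm_apply_apply]
        · rw [← h4, LieEquiv.symm_apply_apply]
        · rw [← h5, LieEquiv.apply_symm_apply]
        · rw [← h6, LieEquiv.apply_symm_apply]
      trans := by
        rintro E F G ⟨ψ₁, ψ₀, h1, h2, h3, h4, h5, h6⟩ ⟨χ₁, χ₀, k1, k2, k3, k4, k5, k6⟩
        refine ⟨ψ₁.trans χ₁, ψ₀.trans χ₀, fun e => ?_, fun f e => ?_, fun w => ?_, fun v => ?_,
          fun e => ?_, fun f => ?_⟩ <;> simp only [LieEquiv.trans_apply]
        · rw [h1, k1]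
        · rw [h2, k2]
        · rw [h3, k3]
        · rw [h4, k4]
        · rw [k5, h5]
        · rw [k6, h6] }

/-- Equivalence classes of extensions inducing `ρ`. -/
def ExtensionClass (ρ : TwoRep M phi) : Type (max (u + 1) v) :=
  Quotient (extensionSetoid ρ)

/-- The class of an extension inducing `ρ`. -/
def ExtensionClass.mk {ρ : TwoRep M phi} (E : {E : Extension M phi // E.Induces ρ}) :
    ExtensionClass ρ :=
  Quotient.mk (extensionSetoid ρ) E

/-- `c` is the 2-cochain `(ω₀, α, φ, ω₁, 0, 0)` measuring the failure of the splitting `σ` to be a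
morphism of crossed modules:
`ω₀(y₀, y₁) = σ₀[y₀, y₁] - [σ₀ y₀, σ₀ y₁]`, `α(y; x) = σ₁(y · x) - σ₀ y · σ₁ x`,
`φ(x) = eps (σ₁ x) - σ₀ (mu x)`, `ω₁(x₀, x₁) = σ₁[x₀, x₁] - [σ₁ x₀, σ₁ x₁]`. -/
def Extension.IsCochainOf (E : Extension M phi) (σ : E.Splitting) (c : PreCochain g h W V) :
    Prop :=
  c ∈ Cochain 𝕜 g h W V 2 ∧
  (∀ Y, E.j₀ (c.1 0 2 Y) = σ.σ₀ ⁅(Y 0).2, (Y 1).2⁆ - ⁅σ.σ₀ (Y 0).2, σ.σ₀ (Y 1).2⁆) ∧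
  (∀ Y X, E.j₁ (c.2 0 1 0 Y X) =
    σ.σ₁ (M.act (Y 0).2 (X 0)) - E.eps.act (σ.σ₀ (Y 0).2) (σ.σ₁ (X 0))) ∧
  (∀ ξ, E.j₀ (c.1 1 1 ξ) = E.eps.mu (σ.σ₁ ((ξ 0).1 0)) - σ.σ₀ (M.mu ((ξ 0).1 0))) ∧
  (∀ Y X, E.j₁ (c.2 0 0 1 Y X) = σ.σ₁ ⁅X 0, X 1⁆ - ⁅σ.σ₁ (X 0), σ.σ₁ (X 1)⁆) ∧
  c.2 1 0 0 = 0 ∧ c.1 2 0 = 0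

end Extensions

end LieTwo

/-! Over a field every extension has a linear splitting `σ`, which identifies `e₁` with `W × g` and
`e₀` with `V × h`. Since `W → V` carries zero brackets and zero action, the way an element of `e₀`
or `e₁` acts on the kernel depends only on its image under `π`. This gives the 2-representation, its
uniqueness and its independence of the splitting (`exists_actsBy`, `exists_unique_induced`).

The remaining structure of the extension is contained in the four maps `ω₀`, `α`, `φ`, `ω₁` that
measure how far `σ` is from a morphism. In the coordinates given by `σ`, the brackets, the structure
map and the action are explicit expressions in `ρ` and these maps. Jacobi, derivation, action,
equivariance and Peiffer identities then yield the equations `∇c = 0` (`HasCochain.isCocycle`).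
Conversely these equations make the same expressions a crossed module (`totalCrossedModule`), and
two extensions with the same four maps are isomorphic (`Equivalent.of_hasCochain`).

A general 2-cocycle has additional components: `u ∈ V` in tridegree (2,0,0), `lam` in (1,0,1), and
the dependence `bh` of the (1,1,0) component on `h`. The equations in tridegrees (2,0,1) and (2,1,0)
force `lam x = ρ₁(x)u` and `bh y = ρ₀⁰(y)u`. These are the corresponding components of `∇` applied
to `u`, viewed as a 1-cochain in tridegree (1,0,0), so subtracting that coboundary removes all three
(`exists_normalized`).

Changing `σ` by `(l0, l1)` changes the cocycle by `∇(l0, l1, 0)` up to sign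
(`HasCochain.sub_shift`), so the class is well defined. If the normalized cocycles of two extensions
differ by `∇(l0, l1, v)`, comparison in tridegree (2,0,0) gives `v = 0`, and a change of splitting
makes the cocycles equal. This gives injectivity; surjectivity follows from normalization and
`totalExtension`. -/

namespace LieTwo

/-! ### Alternating functions of at most two arguments -/

section Alternating

variable {𝕜 : Type v} [Field 𝕜] {A N : Type u} [AddCommGroup A] [Module 𝕜 A]
  [AddCommGroup N] [Module 𝕜 N]

theorem isAlternating_zero {q : ℕ} : IsAlternating 𝕜 (0 : (Fin q → A) → N) := ⟨0, rfl⟩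

theorem isAlternating_const (f : (Fin 0 → A) → N) : IsAlternating 𝕜 f :=
  ⟨AlternatingMap.constOfIsEmpty 𝕜 A (Fin 0) (f Fin.elim0), by
    funext X; exact congrArg f (Subsingleton.elim _ _)⟩

theorem isAlternating_of_linear (L : A →ₗ[𝕜] N) :
    IsAlternating 𝕜 (fun X : Fin 1 → A => L (X 0)) :=
  ⟨AlternatingMap.ofSubsingleton 𝕜 A N (0 : Fin 1) L, rfl⟩

theorem IsAlternating.exists_linear {f : (Fin 1 → A) → N} (hf : IsAlternating 𝕜 f) :
    ∃ L : A →ₗ[𝕜] N, ∀ x, f (fun _ => x) = L x := by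
  obtain ⟨F, rfl⟩ := hf
  exact ⟨(AlternatingMap.ofSubsingleton 𝕜 A N (0 : Fin 1)).symm F, fun x => rfl⟩

theorem isAlternating_of_bilinear (B : A →ₗ[𝕜] A →ₗ[𝕜] N) (hB : ∀ x, B x x = 0) :
    IsAlternating 𝕜 (fun X : Fin 2 → A => B (X 0) (X 1)) := by
  refine ⟨{ toFun := fun X => B (X 0) (X 1)
            map_update_add' := ?_
            map_update_smul' := ?_
            map_eq_zero_of_eq' := ?_ }, rfl⟩
  · intro _ X i x y
    fin_cases i <;> simp [Function.update]
  · intro _ X i a x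
    fin_cases i <;> simp [Function.update]
  · intro X i j hX hij
    fin_cases i <;> fin_cases j <;> simp_all

theorem IsAlternating.exists_bilinear {f : (Fin 2 → A) → N} (hf : IsAlternating 𝕜 f) :
    ∃ B : A →ₗ[𝕜] A →ₗ[𝕜] N, (∀ x, B x x = 0) ∧ ∀ x y, f ![x, y] = B x y := by
  obtain ⟨F, rfl⟩ := hf
  have e0 : ∀ x y z : A, Function.update ![x, y] 0 z = ![z, y] := fun x y z => by
    funext i; fin_cases i <;> rfl
  have e1 : ∀ x y z : A, Function.update ![x, y] 1 z = ![x, z] := fun x y z => by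
    funext i; fin_cases i <;> rfl
  refine ⟨LinearMap.mk₂ 𝕜 (fun x y => F ![x, y]) ?_ ?_ ?_ ?_, fun x => ?_, fun x y => rfl⟩
  · intro x x' y
    simpa only [e0] using F.map_update_add ![x, y] 0 x x'
  · intro a x y
    simpa only [e0] using F.map_update_smul ![x, y] 0 a x
  · intro x y y'
    simpa only [e1] using F.map_update_add ![x, y] 1 y y'
  · intro a x y
    simpa only [e1] using F.map_update_smul ![x, y] 1 a y
  · exact F.map_eq_zero_of_eq ![x, x] (i := 0) (j := 1) rfl (by decide)

end Alternating

/-! ### Difference maps in low degree -/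

section Low

variable {𝕜 : Type v} [Field 𝕜] {g h : Type u}
  [LieRing g] [LieAlgebra 𝕜 g] [LieRing h] [LieAlgebra 𝕜 h]
  {N : Type u} [AddCommGroup N] [Module 𝕜 N]

theorem orderEmbOfFin_of_eq_singleton {n : ℕ} (s : Finset (Fin n)) (hs : s.card = 1) (a : Fin n)
    (ha : s = {a}) (i : Fin 1) : s.orderEmbOfFin hs i = a := by
  have hm : s.orderEmbOfFin hs i ∈ ({a} : Finset (Fin n)) := ha ▸ s.orderEmbOfFin_mem hs i
  exact Finset.mem_singleton.mp hm

theorem differenceMap_zero_one (M : CrossedModule 𝕜 g h) (p : ℕ)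
    (ω : (Fin 0 → Nerve g h p) → (Fin 1 → g) → N) (Ξ : Fin (0 + 1) → Nerve g h (p + 1)) :
    differenceMap M p 0 1 ω Ξ = ω Fin.elim0 (fun _ => (Ξ 0).1 0) := by
  -- For `q = 0` the whole index set is the only subset of the required size, so the sum has a
  -- single term.
  have : Subsingleton {A : Finset (Fin (0 + 1)) // A.card = 1} :=
    ⟨by rintro ⟨A, hA⟩ ⟨B, hB⟩; revert A B; decide⟩
  rw [differenceMap, Fintype.sum_subsingleton _ ⟨{0}, rfl⟩]
  simp only [Finset.sum_singleton]
  rw [show ((-1 : 𝕜) ^ ((0 : Fin (0 + 1)).val)) = 1 by simp]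
  simp only [Nat.sub_self, zero_mul, Nat.mul_zero, Nat.zero_div, one_smul]
  simp only [orderEmbOfFin_of_eq_singleton {0} _ 0 rfl, add_zero, pow_zero, one_smul]
  exact congrArg₂ ω (Subsingleton.elim _ _) rfl

theorem differenceMap_zero_two (M : CrossedModule 𝕜 g h) (p : ℕ)
    (ω : (Fin 0 → Nerve g h p) → (Fin 2 → g) → N) (Ξ : Fin (0 + 2) → Nerve g h (p + 1)) :
    differenceMap M p 0 2 ω Ξ = ω Fin.elim0 ![(Ξ 0).1 0, (Ξ 1).1 0] := by
  have : Subsingleton {A : Finset (Fin (0 + 2)) // A.card = 2} :=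
    ⟨by rintro ⟨A, hA⟩ ⟨B, hB⟩; revert A B; decide⟩
  rw [differenceMap, Fintype.sum_subsingleton _ ⟨{0, 1}, by decide⟩]
  rw [show (∑ a ∈ ({0, 1} : Finset (Fin (0 + 2))), a.val) = 1 from rfl]
  simp only [smul_smul]
  -- The prefactor `(-1)^{k(k-1)/2} = -1` cancels the sign `(-1)^{0+1}` of the subset `{0, 1}`.
  rw [show ((-1 : 𝕜) ^ ((2 - 1) * 0 + 2 * (2 - 1) / 2) * (-1) ^ 1) = 1 by norm_num, one_smul]
  have he : ∀ (hs : ({0, 1} : Finset (Fin (0 + 2))).card = 2) (i : Fin 2),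
      ({0, 1} : Finset (Fin (0 + 2))).orderEmbOfFin hs i = i := fun hs i =>
    (congrFun (Finset.orderEmbOfFin_unique (s := ({0, 1} : Finset (Fin (0 + 2))))
      (k := 2) (f := fun i : Fin 2 => (i : Fin (0 + 2))) hs (by decide) strictMono_id) i).symm
  refine congrArg₂ ω (Subsingleton.elim _ _) (funext fun i => ?_)
  refine (congrArg (fun j => (Ξ j).1 0) (he _ i)).trans ?_
  fin_cases i <;> rfl

theorem differenceMap_one_one (M : CrossedModule 𝕜 g h) (p : ℕ)
    (ω : (Fin 1 → Nerve g h p) → (Fin 1 → g) → N) (Ξ : Fin (1 + 1) → Nerve g h (p + 1)) :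
    differenceMap M p 1 1 ω Ξ = ω (fun _ => face M 0 (Ξ 1)) (fun _ => (Ξ 0).1 0) -
      ω (fun _ => face M 0 (Ξ 0)) (fun _ => (Ξ 1).1 0) := by
  have hu : (Finset.univ : Finset {A : Finset (Fin (1 + 1)) // A.card = 1}) =
      {⟨{0}, rfl⟩, ⟨{1}, rfl⟩} := by
    decide
  rw [differenceMap, hu, Finset.sum_pair (by decide)]
  simp only [Finset.sum_singleton]
  rw [show ((-1 : 𝕜) ^ ((0 : Fin (1 + 1)).val)) = 1 by simp,
    show ((-1 : 𝕜) ^ ((1 : Fin (1 + 1)).val)) = -1 by simp]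
  simp only [Nat.sub_self, zero_mul, Nat.mul_zero, Nat.zero_div, pow_zero, one_smul, neg_smul,
    add_zero, ← sub_eq_add_neg]
  have h0 : ({0}ᶜ : Finset (Fin (1 + 1))) = {1} := by decide
  have h1 : ({1}ᶜ : Finset (Fin (1 + 1))) = {0} := by decide
  simp only [orderEmbOfFin_of_eq_singleton {0} _ 0 rfl, orderEmbOfFin_of_eq_singleton {1} _ 1 rfl,
    orderEmbOfFin_of_eq_singleton {0}ᶜ _ 1 h0, orderEmbOfFin_of_eq_singleton {1}ᶜ _ 0 h1]

end Low
-- 2-cochains as tuples of linear maps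
section TwoCochains

/-- The components of a 2-cochain, as linear maps: `om0`, `al`, `om1`, `lam` and `u` are the
components in tridegrees `(0, 2, 0)`, `(0, 1, 1)`, `(0, 0, 2)`, `(1, 0, 1)` and `(2, 0, 0)`, and
`(x; y) ↦ ph x + bh y` is the one in tridegree `(1, 1, 0)`. -/
structure TwoCochain (𝕜 : Type v) [Field 𝕜] (g h W V : Type u)
    [LieRing g] [LieAlgebra 𝕜 g] [LieRing h] [LieAlgebra 𝕜 h]
    [AddCommGroup W] [Module 𝕜 W] [AddCommGroup V] [Module 𝕜 V] where
  om0 : h →ₗ[𝕜] h →ₗ[𝕜] V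
  al : h →ₗ[𝕜] g →ₗ[𝕜] W
  ph : g →ₗ[𝕜] V
  bh : h →ₗ[𝕜] V
  om1 : g →ₗ[𝕜] g →ₗ[𝕜] W
  lam : g →ₗ[𝕜] W
  u : V
  om0_self : ∀ y, om0 y y = 0
  om1_self : ∀ x, om1 x x = 0

variable {𝕜 : Type v} [Field 𝕜] {g h W V : Type u}
  [LieRing g] [LieAlgebra 𝕜 g] [LieRing h] [LieAlgebra 𝕜 h]
  [AddCommGroup W] [Module 𝕜 W] [AddCommGroup V] [Module 𝕜 V]
  {M : CrossedModule 𝕜 g h} {phi : W →ₗ[𝕜] V}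

/-- The family of functions given by the components of a 2-cochain. -/
def TwoCochain.toPre (d : TwoCochain 𝕜 g h W V) : PreCochain g h W V :=
  (fun p q => match p, q with
    | 0, 2 => fun Y => d.om0 (Y 0).2 (Y 1).2
    | 1, 1 => fun Y => d.ph ((Y 0).1 0) + d.bh (Y 0).2
    | 2, 0 => fun _ => d.u
    | _, _ => 0,
  -- The last index is one less than the third entry of the tridegree: `0, 1, 0` stands for (0,1,1).
  fun p q r => match p, q, r with
    | 0, 1, 0 => fun Y X => d.al (Y 0).2 (X 0)
    | 0, 0, 1 => fun _ X => d.om1 (X 0) (X 1)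
    | 1, 0, 0 => fun _ X => d.lam (X 0)
    | _, _, _ => 0)

variable (d : TwoCochain 𝕜 g h W V)

theorem TwoCochain.toPre_fst_eq_zero (p q : ℕ) (hpq : p + q ≠ 2) : d.toPre.1 p q = 0 := by
  rcases p with _ | _ | _ | p <;> rcases q with _ | _ | _ | q <;> first | rfl | omega

theorem TwoCochain.toPre_snd_eq_zero (p q r : ℕ) (hpq : p + q + (r + 1) ≠ 2) :
    d.toPre.2 p q r = 0 := by
  rcases p with _ | _ | p <;> rcases q with _ | _ | q <;> rcases r with _ | _ | r <;>
    first | rfl | omega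

theorem isAlternating_zero_curry {A B N : Type u} [AddCommGroup A] [Module 𝕜 A] [AddCommGroup B]
    [Module 𝕜 B] [AddCommGroup N] [Module 𝕜 N] {q r : ℕ} :
    (∀ Z, IsAlternating 𝕜 (fun Ξ => (0 : (Fin q → A) → (Fin r → B) → N) Ξ Z)) ∧
      ∀ Ξ, IsAlternating 𝕜 ((0 : (Fin q → A) → (Fin r → B) → N) Ξ) :=
  ⟨fun _ => isAlternating_zero, fun _ => isAlternating_zero⟩

theorem TwoCochain.toPre_mem : d.toPre ∈ Cochain 𝕜 g h W V 2 := by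
  refine ⟨fun p q => ?_, fun p q r => ?_, d.toPre_fst_eq_zero, d.toPre_snd_eq_zero⟩
  · by_cases hpq : p + q = 2
    · obtain ⟨rfl, rfl⟩ | ⟨rfl, rfl⟩ | ⟨rfl, rfl⟩ :
        (p = 0 ∧ q = 2) ∨ (p = 1 ∧ q = 1) ∨ (p = 2 ∧ q = 0) := by omega
      · exact isAlternating_of_bilinear (A := Nerve g h 0)
          (d.om0.compl₁₂ (LinearMap.snd 𝕜 (Fin 0 → g) h) (LinearMap.snd 𝕜 (Fin 0 → g) h))
          fun ξ => d.om0_self ξ.2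
      · exact isAlternating_of_linear (A := Nerve g h 1)
          (d.ph ∘ₗ LinearMap.proj (φ := fun _ : Fin 1 => g) 0 ∘ₗ LinearMap.fst 𝕜 (Fin 1 → g) h +
            d.bh ∘ₗ LinearMap.snd 𝕜 (Fin 1 → g) h)
      · exact isAlternating_const _
    · rw [d.toPre_fst_eq_zero p q hpq]; exact isAlternating_zero
  · by_cases hpq : p + q + (r + 1) = 2
    · obtain ⟨rfl, rfl, rfl⟩ | ⟨rfl, rfl, rfl⟩ | ⟨rfl, rfl, rfl⟩ :
        (p = 0 ∧ q = 1 ∧ r = 0) ∨ (p = 0 ∧ q = 0 ∧ r = 1) ∨ (p = 1 ∧ q = 0 ∧ r = 0) := by omega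
      · exact ⟨fun Z => isAlternating_of_linear (A := Nerve g h 0)
            (d.al.flip (Z 0) ∘ₗ LinearMap.snd 𝕜 (Fin 0 → g) h),
          fun Ξ => isAlternating_of_linear (d.al (Ξ 0).2)⟩
      · exact ⟨fun Z => isAlternating_const _,
          fun Ξ => isAlternating_of_bilinear d.om1 d.om1_self⟩
      · exact ⟨fun Z => isAlternating_const _, fun Ξ => isAlternating_of_linear d.lam⟩
    · rw [d.toPre_snd_eq_zero p q r hpq]; exact isAlternating_zero_curry

theorem exists_toPre_eq {c : PreCochain g h W V} (hc : c ∈ Cochain 𝕜 g h W V 2) :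
    ∃ d : TwoCochain 𝕜 g h W V, d.toPre = c := by
  obtain ⟨h1, h2, h3, h4⟩ := hc
  let i0 : h →ₗ[𝕜] Nerve g h 0 := LinearMap.inr 𝕜 _ _
  let i1 : h →ₗ[𝕜] Nerve g h 1 := LinearMap.inr 𝕜 _ _
  let k1 : g →ₗ[𝕜] Nerve g h 1 := LinearMap.inl 𝕜 _ _ ∘ₗ LinearMap.pi fun _ => LinearMap.id
  have e0 : ∀ ξ : Nerve g h 0, i0 ξ.2 = ξ := fun ξ => Prod.ext (Subsingleton.elim _ _) rfl
  have e1 : ∀ ξ : Nerve g h 1, k1 (ξ.1 0) + i1 ξ.2 = ξ := fun ξ => by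
    refine Prod.ext (funext fun i => ?_) ?_
    · rw [Subsingleton.elim i 0]; simp [k1, i1]
    · simp [k1, i1]
  obtain ⟨A, hA, hA'⟩ := (h1 0 2).exists_bilinear
  obtain ⟨B, hB⟩ := (h1 1 1).exists_linear
  have hL : ∀ x : g, ∃ L : Nerve g h 0 →ₗ[𝕜] W, ∀ ξ, c.2 0 1 0 (fun _ => ξ) (fun _ => x) = L ξ :=
    fun x => ((h2 0 1 0).1 _).exists_linear
  have hL' : ∀ ξ : Nerve g h 0, ∃ L : g →ₗ[𝕜] W,
      ∀ x, c.2 0 1 0 (fun _ => ξ) (fun _ => x) = L x := fun ξ => ((h2 0 1 0).2 _).exists_linear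
  choose L hL using hL
  choose L' hL' using hL'
  -- The cochain condition gives linearity in each group separately: `L x` is linear in `ξ` and `L'
  -- ξ` in `x`. Their agreement makes `al` bilinear.
  have hLL : ∀ ξ x, L x ξ = L' ξ x := fun ξ x => by rw [← hL, ← hL']
  obtain ⟨D, hD, hD'⟩ := ((h2 0 0 1).2 Fin.elim0).exists_bilinear
  obtain ⟨E, hE⟩ := ((h2 1 0 0).2 Fin.elim0).exists_linear
  let d : TwoCochain 𝕜 g h W V :=
    { om0 := A.compl₁₂ i0 i0
      al := LinearMap.mk₂ 𝕜 (fun y x => L' (i0 y) x)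
        (fun y y' x => by simp only [← hLL, map_add]) (fun a y x => by simp only [← hLL, map_smul])
        (fun y x x' => by simp only [map_add]) (fun a y x => by simp only [map_smul])
      ph := B ∘ₗ k1
      bh := B ∘ₗ i1
      om1 := D
      lam := E
      u := c.1 2 0 Fin.elim0
      om0_self := fun y => hA _
      om1_self := hD }
  have cons1 : ∀ {A : Type u} (X : Fin 1 → A), (fun _ => X 0) = X := fun X =>
    funext fun i => congrArg X (Subsingleton.elim _ _)
  have cons2 : ∀ {A : Type u} (X : Fin 2 → A), ![X 0, X 1] = X := fun X =>
    funext fun i => by fin_cases i <;> rfl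
  refine ⟨d, Prod.ext (funext fun p => funext fun q => ?_)
    (funext fun p => funext fun q => funext fun r => ?_)⟩
  · by_cases hpq : p + q = 2
    · obtain ⟨rfl, rfl⟩ | ⟨rfl, rfl⟩ | ⟨rfl, rfl⟩ :
        (p = 0 ∧ q = 2) ∨ (p = 1 ∧ q = 1) ∨ (p = 2 ∧ q = 0) := by omega
      · funext Y
        change A (i0 (Y 0).2) (i0 (Y 1).2) = _
        rw [e0, e0, ← hA', cons2]
      · funext Y
        change B (k1 ((Y 0).1 0)) + B (i1 (Y 0).2) = _
        rw [← map_add, e1, ← hB, cons1]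
      · funext Y
        exact congrArg (c.1 2 0) (Subsingleton.elim _ _)
    · rw [d.toPre_fst_eq_zero p q hpq, h3 p q hpq]
  · by_cases hpq : p + q + (r + 1) = 2
    · obtain ⟨rfl, rfl, rfl⟩ | ⟨rfl, rfl, rfl⟩ | ⟨rfl, rfl, rfl⟩ :
        (p = 0 ∧ q = 1 ∧ r = 0) ∨ (p = 0 ∧ q = 0 ∧ r = 1) ∨ (p = 1 ∧ q = 0 ∧ r = 0) := by omega
      · funext Y X
        change L' (i0 (Y 0).2) (X 0) = _
        rw [e0, ← hL', cons1, cons1]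
      · funext Y X
        change D (X 0) (X 1) = _
        rw [← hD', cons2, Subsingleton.elim Y Fin.elim0]
      · funext Y X
        change E (X 0) = _
        rw [← hE, cons1, Subsingleton.elim Y Fin.elim0]
    · rw [d.toPre_snd_eq_zero p q r hpq, h4 p q r hpq]

theorem ceDiff_zero {A N : Type u} [AddCommGroup N] [Module 𝕜 N] (br : A → A → A)
    (rep : A → N →ₗ[𝕜] N) (q : ℕ) (X : Fin (q + 1) → A) : ceDiff 𝕜 br rep q 0 X = 0 := by
  simpa using ceDiff_smul (𝕜 := 𝕜) br rep q 0 0 X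

theorem simplicialDiff_zero {N : Type u} [AddCommGroup N] [Module 𝕜 N] (M : CrossedModule 𝕜 g h)
    (p q : ℕ) (Ξ : Fin q → Nerve g h (p + 1)) :
    simplicialDiff M p q (0 : (Fin q → Nerve g h p) → N) Ξ = 0 := by
  simp [simplicialDiff]

theorem differenceMap_zero {N : Type u} [AddCommGroup N] [Module 𝕜 N] (M : CrossedModule 𝕜 g h)
    (p q k : ℕ) (Ξ : Fin (q + k) → Nerve g h (p + 1)) :
    differenceMap M p q k (0 : (Fin q → Nerve g h p) → (Fin k → g) → N) Ξ = 0 := by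
  simp [differenceMap]

/-- The differential raises the total degree by one. -/
theorem nabla_fst_eq_zero (ρ : TwoRep M phi) {c : PreCochain g h W V} {n : ℕ}
    (hV : ∀ p q, p + q ≠ n → c.1 p q = 0) (hW : ∀ p q r, p + q + (r + 1) ≠ n → c.2 p q r = 0)
    (p q : ℕ) (hpq : p + q ≠ n + 1) : (nabla ρ c).1 p q = 0 := by
  funext Ξ
  have hδ : deltaV ρ c p q Ξ = 0 := by
    cases q with
    | zero => rfl
    | succ q => rw [deltaV, hV p q (by omega), ceDiff_zero]
  have hh : horizontalV M phi c p q Ξ = 0 := by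
    cases p with
    | zero => rfl
    | succ p =>
      rw [horizontalV, hV p q (by omega), simplicialDiff_zero, smul_zero, zero_add]
      refine Finset.sum_eq_zero fun k _ => ?_
      have : (fun Ξ' X => phi (c.2 p (q - (k.val + 1)) k.val Ξ' X)) = 0 := by
        funext Ξ' X
        rw [hW p _ k.val (by omega)]
        exact map_zero phi
      rw [this, differenceMap_zero, smul_zero]
  change deltaV ρ c p q Ξ + horizontalV M phi c p q Ξ = 0
  rw [hδ, hh, add_zero]

theorem nabla_snd_eq_zero (ρ : TwoRep M phi) {c : PreCochain g h W V} {n : ℕ}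
    (hV : ∀ p q, p + q ≠ n → c.1 p q = 0) (hW : ∀ p q r, p + q + (r + 1) ≠ n → c.2 p q r = 0)
    (p q r : ℕ) (hpq : p + q + (r + 1) ≠ n + 1) : (nabla ρ c).2 p q r = 0 := by
  funext Ξ Z
  have hδ : deltaW ρ c p q r Ξ Z = 0 := by
    cases q with
    | zero => rfl
    | succ q => rw [deltaW, hW p q r (by omega), ceDiff_zero]; rfl
  have h1 : deltaOne ρ c p q r Ξ Z = 0 := by
    cases r with
    | zero => rw [deltaOne, hV p q (by omega)]; exact map_zero _
    | succ r => rw [deltaOne, hW p q r (by omega)]; exact ceDiff_zero ..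
  have hh : horizontalW M c p q r Ξ Z = 0 := by
    cases p with
    | zero => rfl
    | succ p =>
      rw [horizontalW, hW p q r (by omega)]
      have hs : simplicialDiff M p q (fun Ξ' => (0 : (Fin q → Nerve g h p) →
          (Fin (r + 1) → g) → W) Ξ' Z) Ξ = 0 := simplicialDiff_zero M p q Ξ
      rw [hs, smul_zero, zero_add]
      refine Finset.sum_eq_zero fun k _ => ?_
      rw [hW p _ (k.val + 1 + r) (by omega)]
      exact (congrArg _ (differenceMap_zero M _ _ _ _)).trans (smul_zero _)
  change deltaW ρ c p q r Ξ Z + (-1 : 𝕜) ^ q • deltaOne ρ c p q r Ξ Z +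
      horizontalW M c p q r Ξ Z = 0
  rw [hδ, hh, h1, smul_zero, add_zero, add_zero]

end TwoCochains
-- The differential of a 2-cochain, tridegree by tridegree
section NablaTwo

theorem ceDiff_zero_deg {𝕜 : Type v} [Field 𝕜] {A N : Type u} [AddCommGroup N] [Module 𝕜 N]
    (br : A → A → A) (rep : A → N →ₗ[𝕜] N) (ω : (Fin 0 → A) → N) (X : Fin 1 → A) :
    ceDiff 𝕜 br rep 0 ω X = rep (X 0) (ω Fin.elim0) := by
  change (∑ j : Fin 1, (-1 : 𝕜) ^ j.val • rep (X j) (ω (j.removeNth X))) + 0 = _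
  rw [Fin.sum_univ_one, Subsingleton.elim (Fin.removeNth 0 X) Fin.elim0]
  simp

theorem ceDiff_one {𝕜 : Type v} [Field 𝕜] {A N : Type u} [AddCommGroup N] [Module 𝕜 N]
    (br : A → A → A) (rep : A → N →ₗ[𝕜] N) (ω : (Fin 1 → A) → N) (X : Fin 2 → A) :
    ceDiff 𝕜 br rep 1 ω X = rep (X 0) (ω fun _ => X 1) - rep (X 1) (ω fun _ => X 0) -
      ω fun _ => br (X 0) (X 1) := by
  change (∑ j : Fin 2, (-1 : 𝕜) ^ j.val • rep (X j) (ω (j.removeNth X))) +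
    (∑ n : Fin 2, ∑ m : Fin 1, if m.castSucc < n then (-1 : 𝕜) ^ (m.val + n.val) •
      ω (Fin.cons (br (X m.castSucc) (X n)) (m.removeNth (n.removeNth X))) else 0) = _
  have h0 : (0 : Fin 2).removeNth X = fun _ => X 1 := by funext i; fin_cases i; rfl
  have h1 : (1 : Fin 2).removeNth X = fun _ => X 0 := by funext i; fin_cases i; rfl
  have hc : ∀ (a : A) (Y : Fin 0 → A), (Fin.cons a Y : Fin 1 → A) = fun _ => a := fun a Y => by
    funext i; fin_cases i; rfl
  simp only [Fin.sum_univ_two, Fin.sum_univ_one, h0, h1, hc]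
  simp [sub_eq_add_neg]

theorem ceDiff_two {𝕜 : Type v} [Field 𝕜] {A N : Type u} [AddCommGroup N] [Module 𝕜 N]
    (br : A → A → A) (rep : A → N →ₗ[𝕜] N) (ω : (Fin 2 → A) → N) (X : Fin 3 → A) :
    ceDiff 𝕜 br rep 2 ω X = rep (X 0) (ω ![X 1, X 2]) - rep (X 1) (ω ![X 0, X 2]) +
      rep (X 2) (ω ![X 0, X 1]) - ω ![br (X 0) (X 1), X 2] + ω ![br (X 0) (X 2), X 1] -
      ω ![br (X 1) (X 2), X 0] := by
  change (∑ j : Fin 3, (-1 : 𝕜) ^ j.val • rep (X j) (ω (j.removeNth X))) +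
    (∑ n : Fin 3, ∑ m : Fin 2, if m.castSucc < n then (-1 : 𝕜) ^ (m.val + n.val) •
      ω (Fin.cons (br (X m.castSucc) (X n)) (m.removeNth (n.removeNth X))) else 0) = _
  have h0 : (0 : Fin 3).removeNth X = ![X 1, X 2] := by funext i; fin_cases i <;> rfl
  have h1 : (1 : Fin 3).removeNth X = ![X 0, X 2] := by funext i; fin_cases i <;> rfl
  have h2 : (2 : Fin 3).removeNth X = ![X 0, X 1] := by funext i; fin_cases i <;> rfl
  have k0 : ∀ x y : A, (0 : Fin 2).removeNth ![x, y] = ![y] := fun x y => by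
    funext i; fin_cases i; rfl
  have k1 : ∀ x y : A, (1 : Fin 2).removeNth ![x, y] = ![x] := fun x y => by
    funext i; fin_cases i; rfl
  have hc : ∀ (a b : A), (Fin.cons a ![b] : Fin 2 → A) = ![a, b] := fun a b => rfl
  simp only [Fin.sum_univ_three, Fin.sum_univ_two, h0, h1, h2, k0, k1, hc]
  simp [pow_succ]
  abel

variable {𝕜 : Type v} [Field 𝕜] {g h W V : Type u}
  [LieRing g] [LieAlgebra 𝕜 g] [LieRing h] [LieAlgebra 𝕜 h]
  [AddCommGroup W] [Module 𝕜 W] [AddCommGroup V] [Module 𝕜 V]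
  {M : CrossedModule 𝕜 g h} {phi : W →ₗ[𝕜] V}

/-- The cocycle equations in terms of the components of a 2-cochain, named after the tridegrees. -/
structure TwoCochain.IsCocycle (ρ : TwoRep M phi) (d : TwoCochain 𝕜 g h W V) : Prop where
  eq030 : ∀ y₀ y₁ y₂, ρ.onV y₀ (d.om0 y₁ y₂) - ρ.onV y₁ (d.om0 y₀ y₂) + ρ.onV y₂ (d.om0 y₀ y₁) -
    d.om0 ⁅y₀, y₁⁆ y₂ + d.om0 ⁅y₀, y₂⁆ y₁ - d.om0 ⁅y₁, y₂⁆ y₀ = 0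
  eq021 : ∀ y₀ y₁ x, ρ.onW y₀ (d.al y₁ x) - d.al y₁ (M.act y₀ x) -
    (ρ.onW y₁ (d.al y₀ x) - d.al y₀ (M.act y₁ x)) - d.al ⁅y₀, y₁⁆ x +
    ρ.one x (d.om0 y₀ y₁) = 0
  eq012 : ∀ y x₀ x₁, ρ.onW y (d.om1 x₀ x₁) - d.om1 (M.act y x₀) x₁ - d.om1 x₀ (M.act y x₁) -
    (ρ.onW (M.mu x₀) (d.al y x₁) - ρ.onW (M.mu x₁) (d.al y x₀) - d.al y ⁅x₀, x₁⁆) = 0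
  eq003 : ∀ x₀ x₁ x₂, ρ.onW (M.mu x₀) (d.om1 x₁ x₂) - ρ.onW (M.mu x₁) (d.om1 x₀ x₂) +
    ρ.onW (M.mu x₂) (d.om1 x₀ x₁) -
    d.om1 ⁅x₀, x₁⁆ x₂ + d.om1 ⁅x₀, x₂⁆ x₁ - d.om1 ⁅x₁, x₂⁆ x₀ = 0
  eq120 : ∀ x₀ y₀ x₁ y₁, ρ.onV (y₀ + M.mu x₀) (d.ph x₁ + d.bh y₁) -
    ρ.onV (y₁ + M.mu x₁) (d.ph x₀ + d.bh y₀) -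
    (d.ph (⁅x₀, x₁⁆ + M.act y₀ x₁ - M.act y₁ x₀) + d.bh ⁅y₀, y₁⁆) +
    (d.om0 y₀ y₁ - d.om0 (y₀ + M.mu x₀) (y₁ + M.mu x₁)) -
    (phi (d.al y₁ x₀) - phi (d.al y₀ x₁)) + phi (d.om1 x₀ x₁) = 0
  eq111 : ∀ x₀ y₀ x, ρ.onW (y₀ + M.mu x₀) (d.lam x) - d.lam (M.act (y₀ + M.mu x₀) x) -
    ρ.one x (d.ph x₀ + d.bh y₀) + (d.al y₀ x - d.al (y₀ + M.mu x₀) x) + d.om1 x₀ x = 0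
  eq102 : ∀ x₀ x₁, ρ.onW (M.mu x₀) (d.lam x₁) - ρ.onW (M.mu x₁) (d.lam x₀) - d.lam ⁅x₀, x₁⁆ = 0
  eq210 : ∀ x₀ x₁ y, ρ.onV (y + (M.mu x₀ + M.mu x₁)) d.u - (d.ph x₁ + d.bh y -
    (d.ph (x₀ + x₁) + d.bh y) + (d.ph x₀ + d.bh (y + M.mu x₁))) - phi (d.lam x₀) = 0
  eq201 : ∀ x, ρ.one x d.u - d.lam x = 0

variable (ρ : TwoRep M phi) (d : TwoCochain 𝕜 g h W V)

theorem nabla_fst_apply (c : PreCochain g h W V) (p q : ℕ) (Ξ : Fin q → Nerve g h p) :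
    (nabla ρ c).1 p q Ξ = deltaV ρ c p q Ξ + horizontalV M phi c p q Ξ := rfl

theorem nabla_snd_apply (c : PreCochain g h W V) (p q r : ℕ) (Ξ : Fin q → Nerve g h p)
    (Z : Fin (r + 1) → g) :
    (nabla ρ c).2 p q r Ξ Z = deltaW ρ c p q r Ξ Z + (-1 : 𝕜) ^ q • deltaOne ρ c p q r Ξ Z +
      horizontalW M c p q r Ξ Z := rfl

theorem finalTarget_zero (ξ : Nerve g h 0) : finalTarget M ξ = ξ.2 := by simp [finalTarget]

theorem finalTarget_one (ξ : Nerve g h 1) : finalTarget M ξ = ξ.2 + M.mu (ξ.1 0) := by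
  simp [finalTarget]

theorem finalTarget_two (ξ : Nerve g h 2) :
    finalTarget M ξ = ξ.2 + (M.mu (ξ.1 0) + M.mu (ξ.1 1)) := by
  simp [finalTarget]

theorem sourceAt_one (ξ : Nerve g h 1) : sourceAt M ξ 0 = ξ.2 := by
  simp [sourceAt]

theorem simplicialDiff_deg_zero {N : Type u} [AddCommGroup N] [Module 𝕜 N] (q : ℕ)
    (ω : (Fin q → Nerve g h 0) → N) (Ξ : Fin q → Nerve g h 1) :
    simplicialDiff M 0 q ω Ξ = ω (fun i => face M 0 (Ξ i)) - ω (fun i => face M 1 (Ξ i)) :=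
  (Fin.sum_univ_two _).trans (by simp [sub_eq_add_neg])

theorem simplicialDiff_deg_one {N : Type u} [AddCommGroup N] [Module 𝕜 N] (q : ℕ)
    (ω : (Fin q → Nerve g h 1) → N) (Ξ : Fin q → Nerve g h 2) :
    simplicialDiff M 1 q ω Ξ = ω (fun i => face M 0 (Ξ i)) - ω (fun i => face M 1 (Ξ i)) +
      ω (fun i => face M 2 (Ξ i)) :=
  (Fin.sum_univ_three _).trans (by simp [sub_eq_add_neg])

theorem simplicialDiff_deg_two {N : Type u} [AddCommGroup N] [Module 𝕜 N] (q : ℕ)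
    (ω : (Fin q → Nerve g h 2) → N) (Ξ : Fin q → Nerve g h 3) :
    simplicialDiff M 2 q ω Ξ = ω (fun i => face M 0 (Ξ i)) - ω (fun i => face M 1 (Ξ i)) +
      ω (fun i => face M 2 (Ξ i)) - ω (fun i => face M 3 (Ξ i)) :=
  (Fin.sum_univ_four _).trans (by simp [sub_eq_add_neg, pow_succ])

/-- The degree is written `0 + 1` to match the `repR M ρ (r + 1)` in `deltaW`. -/
theorem repR_one (y : h) (ω : (Fin (0 + 1) → g) → W) (X : Fin (0 + 1) → g) :
    repR M ρ (0 + 1) y ω X = ρ.onW y (ω X) - ω (fun _ => M.act y (X 0)) := by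
  have : Function.update X 0 (M.act y (X 0)) = fun _ => M.act y (X 0) := by
    funext i; fin_cases i; rfl
  simp [repR, this]

theorem repR_two (y : h) (ω : (Fin (1 + 1) → g) → W) (X : Fin (1 + 1) → g) :
    repR M ρ (1 + 1) y ω X =
      ρ.onW y (ω X) - ω ![M.act y (X 0), X 1] - ω ![X 0, M.act y (X 1)] := by
  have h0 : Function.update X 0 (M.act y (X 0)) = ![M.act y (X 0), X 1] := by
    funext i; fin_cases i <;> rfl
  have h1 : Function.update X 1 (M.act y (X 1)) = ![X 0, M.act y (X 1)] := by
    funext i; fin_cases i <;> rfl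
  have hs := Fin.sum_univ_two fun k : Fin 2 => ω (Function.update X k (M.act y (X k)))
  rw [h0, h1] at hs
  exact (congrArg (ρ.onW y (ω X) - ·) hs).trans (sub_sub _ _ _).symm

theorem nabla_toPre_030 (Ξ : Fin 3 → Nerve g h 0) : (nabla ρ d.toPre).1 0 3 Ξ =
    ρ.onV (Ξ 0).2 (d.om0 (Ξ 1).2 (Ξ 2).2) - ρ.onV (Ξ 1).2 (d.om0 (Ξ 0).2 (Ξ 2).2) +
    ρ.onV (Ξ 2).2 (d.om0 (Ξ 0).2 (Ξ 1).2) - d.om0 ⁅(Ξ 0).2, (Ξ 1).2⁆ (Ξ 2).2 +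
    d.om0 ⁅(Ξ 0).2, (Ξ 2).2⁆ (Ξ 1).2 - d.om0 ⁅(Ξ 1).2, (Ξ 2).2⁆ (Ξ 0).2 := by
  rw [nabla_fst_apply, deltaV, horizontalV, ceDiff_two, add_zero]
  simp only [finalTarget_zero]
  rfl

theorem nabla_toPre_021 (Ξ : Fin 2 → Nerve g h 0) (Z : Fin 1 → g) :
    (nabla ρ d.toPre).2 0 2 0 Ξ Z =
    ρ.onW (Ξ 0).2 (d.al (Ξ 1).2 (Z 0)) - d.al (Ξ 1).2 (M.act (Ξ 0).2 (Z 0)) -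
    (ρ.onW (Ξ 1).2 (d.al (Ξ 0).2 (Z 0)) - d.al (Ξ 0).2 (M.act (Ξ 1).2 (Z 0))) -
    d.al ⁅(Ξ 0).2, (Ξ 1).2⁆ (Z 0) + ρ.one (Z 0) (d.om0 (Ξ 0).2 (Ξ 1).2) := by
  rw [nabla_snd_apply, deltaW, deltaOne, horizontalW, ceDiff_one, add_zero]
  simp only [finalTarget_zero, Pi.sub_apply, repR_one, even_two, Even.neg_pow, one_pow, one_smul]
  rfl

theorem nabla_toPre_012 (Ξ : Fin 1 → Nerve g h 0) (Z : Fin 2 → g) :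
    (nabla ρ d.toPre).2 0 1 1 Ξ Z =
    ρ.onW (Ξ 0).2 (d.om1 (Z 0) (Z 1)) - d.om1 (M.act (Ξ 0).2 (Z 0)) (Z 1) -
    d.om1 (Z 0) (M.act (Ξ 0).2 (Z 1)) -
    (ρ.onW (M.mu (Z 0)) (d.al (Ξ 0).2 (Z 1)) - ρ.onW (M.mu (Z 1)) (d.al (Ξ 0).2 (Z 0)) -
      d.al (Ξ 0).2 ⁅Z 0, Z 1⁆) := by
  rw [nabla_snd_apply, deltaW, deltaOne, horizontalW, ceDiff_zero_deg, ceDiff_one, add_zero]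
  simp only [finalTarget_zero, repR_two, pow_one, neg_smul, one_smul, ← sub_eq_add_neg]
  rfl

theorem nabla_toPre_003 (Ξ : Fin 0 → Nerve g h 0) (Z : Fin 3 → g) :
    (nabla ρ d.toPre).2 0 0 2 Ξ Z =
    ρ.onW (M.mu (Z 0)) (d.om1 (Z 1) (Z 2)) - ρ.onW (M.mu (Z 1)) (d.om1 (Z 0) (Z 2)) +
    ρ.onW (M.mu (Z 2)) (d.om1 (Z 0) (Z 1)) - d.om1 ⁅Z 0, Z 1⁆ (Z 2) + d.om1 ⁅Z 0, Z 2⁆ (Z 1) -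
    d.om1 ⁅Z 1, Z 2⁆ (Z 0) := by
  rw [nabla_snd_apply, deltaW, deltaOne, horizontalW, ceDiff_two, add_zero, pow_zero, one_smul,
    zero_add]
  rfl

theorem nabla_toPre_120 (Ξ : Fin 2 → Nerve g h 1) : (nabla ρ d.toPre).1 1 2 Ξ =
    ρ.onV ((Ξ 0).2 + M.mu ((Ξ 0).1 0)) (d.ph ((Ξ 1).1 0) + d.bh (Ξ 1).2) -
    ρ.onV ((Ξ 1).2 + M.mu ((Ξ 1).1 0)) (d.ph ((Ξ 0).1 0) + d.bh (Ξ 0).2) -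
    (d.ph (⁅(Ξ 0).1 0, (Ξ 1).1 0⁆ + M.act (Ξ 0).2 ((Ξ 1).1 0) - M.act (Ξ 1).2 ((Ξ 0).1 0)) +
      d.bh ⁅(Ξ 0).2, (Ξ 1).2⁆) +
    (d.om0 (Ξ 0).2 (Ξ 1).2 -
      d.om0 ((Ξ 0).2 + M.mu ((Ξ 0).1 0)) ((Ξ 1).2 + M.mu ((Ξ 1).1 0))) -
    (phi (d.al (Ξ 1).2 ((Ξ 0).1 0)) - phi (d.al (Ξ 0).2 ((Ξ 1).1 0))) +
    phi (d.om1 ((Ξ 0).1 0) ((Ξ 1).1 0)) := by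
  rw [nabla_fst_apply, deltaV, horizontalV, ceDiff_one, Fin.sum_univ_two]
  have hs : simplicialDiff M 0 2 (d.toPre.1 0 2) Ξ = d.om0 (Ξ 0).2 (Ξ 1).2 -
      d.om0 ((Ξ 0).2 + M.mu ((Ξ 0).1 0)) ((Ξ 1).2 + M.mu ((Ξ 1).1 0)) := by
    simp [simplicialDiff_deg_zero, TwoCochain.toPre, face]
  have h1 := differenceMap_one_one M 0
    (fun Ξ' X => phi (d.toPre.2 0 1 0 Ξ' X)) Ξ
  have h2 := differenceMap_zero_two M 0
    (fun Ξ' X => phi (d.toPre.2 0 0 1 Ξ' X)) Ξ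
  rw [hs]
  -- In the sum over `k` the degrees `q - (k + 1)` and the casts of `Ξ` agree with those in `h1` and
  -- `h2` only by definition, so the two evaluations are inserted by `congrArg` instead of
  -- rewriting.
  refine (congrArg₂ (· + ·) rfl (congrArg₂ (· + ·) rfl (congrArg₂ (· + ·)
    (congrArg _ h1) (congrArg _ h2)))).trans ?_
  simp only [finalTarget_one]
  simp [TwoCochain.toPre, face, nerveBracket, sourceAt_one]
  abel

theorem nabla_toPre_111 (Ξ : Fin 1 → Nerve g h 1) (Z : Fin 1 → g) :
    (nabla ρ d.toPre).2 1 1 0 Ξ Z =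
    ρ.onW ((Ξ 0).2 + M.mu ((Ξ 0).1 0)) (d.lam (Z 0)) -
    d.lam (M.act ((Ξ 0).2 + M.mu ((Ξ 0).1 0)) (Z 0)) -
    ρ.one (Z 0) (d.ph ((Ξ 0).1 0) + d.bh (Ξ 0).2) +
    (d.al (Ξ 0).2 (Z 0) - d.al ((Ξ 0).2 + M.mu ((Ξ 0).1 0)) (Z 0)) +
    d.om1 ((Ξ 0).1 0) (Z 0) := by
  rw [nabla_snd_apply, deltaW, deltaOne, horizontalW, ceDiff_zero_deg, Fin.sum_univ_one]
  have hs : simplicialDiff M 0 1 (fun Ξ' => d.toPre.2 0 1 0 Ξ' Z) Ξ = d.al (Ξ 0).2 (Z 0) -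
      d.al ((Ξ 0).2 + M.mu ((Ξ 0).1 0)) (Z 0) := by
    simp [simplicialDiff_deg_zero, TwoCochain.toPre, face]
  have h1 := differenceMap_zero_one M 0
    (fun Ξ' X => d.toPre.2 0 0 1 Ξ' (Fin.append X Z : Fin (1 + 1) → g)) Ξ
  rw [hs]
  refine (congrArg₂ (· + ·) rfl (congrArg₂ (· + ·) rfl (congrArg _ h1))).trans ?_
  simp only [finalTarget_one, repR_one]
  simp [TwoCochain.toPre, Fin.append, Fin.addCases]
  abel

/-- No `om1` occurs: it does not depend on the nerve, so its contributions from the two faces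
cancel. -/
theorem nabla_toPre_102 (Ξ : Fin 0 → Nerve g h 1) (Z : Fin 2 → g) :
    (nabla ρ d.toPre).2 1 0 1 Ξ Z =
    ρ.onW (M.mu (Z 0)) (d.lam (Z 1)) - ρ.onW (M.mu (Z 1)) (d.lam (Z 0)) - d.lam ⁅Z 0, Z 1⁆ := by
  rw [nabla_snd_apply, deltaW, deltaOne, horizontalW, ceDiff_one]
  simp only [simplicialDiff_deg_zero]
  simp [TwoCochain.toPre]

theorem nabla_toPre_210 (Ξ : Fin 1 → Nerve g h 2) : (nabla ρ d.toPre).1 2 1 Ξ =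
    ρ.onV ((Ξ 0).2 + (M.mu ((Ξ 0).1 0) + M.mu ((Ξ 0).1 1))) d.u -
    (d.ph ((Ξ 0).1 1) + d.bh (Ξ 0).2 - (d.ph ((Ξ 0).1 0 + (Ξ 0).1 1) + d.bh (Ξ 0).2) +
      (d.ph ((Ξ 0).1 0) + d.bh ((Ξ 0).2 + M.mu ((Ξ 0).1 1)))) - phi (d.lam ((Ξ 0).1 0)) := by
  rw [nabla_fst_apply, deltaV, horizontalV, ceDiff_zero_deg, Fin.sum_univ_one]
  have h1 := differenceMap_zero_one M 1 (fun Ξ' X => phi (d.toPre.2 1 0 0 Ξ' X)) Ξ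
  refine (congrArg₂ (· + ·) rfl (congrArg₂ (· + ·) rfl (congrArg _ h1))).trans ?_
  simp only [simplicialDiff_deg_one, finalTarget_two]
  simp [TwoCochain.toPre, face]
  abel

/-- The three faces contribute `lam - lam + lam`, with overall sign `(-1)^{0+1}`. -/
theorem nabla_toPre_201 (Ξ : Fin 0 → Nerve g h 2) (Z : Fin 1 → g) :
    (nabla ρ d.toPre).2 2 0 0 Ξ Z = ρ.one (Z 0) d.u - d.lam (Z 0) := by
  rw [nabla_snd_apply, deltaW, deltaOne, horizontalW]
  simp only [simplicialDiff_deg_one]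
  simp [TwoCochain.toPre, sub_eq_add_neg]

/-- The four faces contribute `u - u + u - u`. Hence this tridegree imposes no condition and has no
field in `TwoCochain.IsCocycle`. -/
theorem nabla_toPre_300 (Ξ : Fin 0 → Nerve g h 3) : (nabla ρ d.toPre).1 3 0 Ξ = 0 := by
  rw [nabla_fst_apply, deltaV, horizontalV]
  simp only [simplicialDiff_deg_two]
  simp [TwoCochain.toPre, pow_succ]

end NablaTwo
-- Cocycle equations, 1-cochains and coboundaries
section OneCochains

variable {𝕜 : Type v} [Field 𝕜] {g h W V : Type u}
  [LieRing g] [LieAlgebra 𝕜 g] [LieRing h] [LieAlgebra 𝕜 h]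
  [AddCommGroup W] [Module 𝕜 W] [AddCommGroup V] [Module 𝕜 V]
  {M : CrossedModule 𝕜 g h} {phi : W →ₗ[𝕜] V}

/-- Only the ten tridegrees of total degree 3 matter. One of them, (3,0,0), vanishes identically;
the other nine are the fields of `IsCocycle`. -/
theorem nabla_toPre_eq_zero_iff (ρ : TwoRep M phi) (d : TwoCochain 𝕜 g h W V) :
    nabla ρ d.toPre = 0 ↔ d.IsCocycle ρ := by
  constructor
  · intro hd
    have hV : ∀ p q Ξ, (nabla ρ d.toPre).1 p q Ξ = 0 := fun p q Ξ => by rw [hd]; rfl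
    have hW : ∀ p q r Ξ Z, (nabla ρ d.toPre).2 p q r Ξ Z = 0 := fun p q r Ξ Z => by rw [hd]; rfl
    exact
      { eq030 := fun y₀ y₁ y₂ => (nabla_toPre_030 ρ d ![(0, y₀), (0, y₁), (0, y₂)]).symm.trans
          (hV ..)
        eq021 := fun y₀ y₁ x => (nabla_toPre_021 ρ d ![(0, y₀), (0, y₁)] ![x]).symm.trans (hW ..)
        eq012 := fun y x₀ x₁ => (nabla_toPre_012 ρ d ![(0, y)] ![x₀, x₁]).symm.trans (hW ..)
        eq003 := fun x₀ x₁ x₂ => (nabla_toPre_003 ρ d ![] ![x₀, x₁, x₂]).symm.trans (hW ..)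
        eq120 := fun x₀ y₀ x₁ y₁ =>
          (nabla_toPre_120 ρ d ![(![x₀], y₀), (![x₁], y₁)]).symm.trans (hV ..)
        eq111 := fun x₀ y₀ x => (nabla_toPre_111 ρ d ![(![x₀], y₀)] ![x]).symm.trans (hW ..)
        eq102 := fun x₀ x₁ => (nabla_toPre_102 ρ d ![] ![x₀, x₁]).symm.trans (hW ..)
        eq210 := fun x₀ x₁ y => (nabla_toPre_210 ρ d ![(![x₀, x₁], y)]).symm.trans (hV ..)
        eq201 := fun x => (nabla_toPre_201 ρ d ![] ![x]).symm.trans (hW ..) }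
  · intro hd
    refine Prod.ext (funext fun p => funext fun q => ?_)
      (funext fun p => funext fun q => funext fun r => ?_)
    · by_cases hpq : p + q = 2 + 1
      · obtain ⟨rfl, rfl⟩ | ⟨rfl, rfl⟩ | ⟨rfl, rfl⟩ | ⟨rfl, rfl⟩ : (p = 0 ∧ q = 3) ∨
          (p = 1 ∧ q = 2) ∨ (p = 2 ∧ q = 1) ∨ (p = 3 ∧ q = 0) := by omega
        · exact funext fun Ξ => (nabla_toPre_030 ρ d Ξ).trans (hd.eq030 ..)
        · exact funext fun Ξ => (nabla_toPre_120 ρ d Ξ).trans (hd.eq120 ..)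
        · exact funext fun Ξ => (nabla_toPre_210 ρ d Ξ).trans (hd.eq210 ..)
        · exact funext fun Ξ => nabla_toPre_300 ρ d Ξ
      · exact nabla_fst_eq_zero ρ d.toPre_fst_eq_zero d.toPre_snd_eq_zero p q hpq
    · by_cases hpq : p + q + (r + 1) = 2 + 1
      · obtain ⟨rfl, rfl, rfl⟩ | ⟨rfl, rfl, rfl⟩ | ⟨rfl, rfl, rfl⟩ | ⟨rfl, rfl, rfl⟩ |
          ⟨rfl, rfl, rfl⟩ | ⟨rfl, rfl, rfl⟩ : (p = 0 ∧ q = 2 ∧ r = 0) ∨ (p = 0 ∧ q = 1 ∧ r = 1) ∨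
          (p = 0 ∧ q = 0 ∧ r = 2) ∨ (p = 1 ∧ q = 1 ∧ r = 0) ∨ (p = 1 ∧ q = 0 ∧ r = 1) ∨
          (p = 2 ∧ q = 0 ∧ r = 0) := by omega
        · exact funext fun Ξ => funext fun Z => (nabla_toPre_021 ρ d Ξ Z).trans (hd.eq021 ..)
        · exact funext fun Ξ => funext fun Z => (nabla_toPre_012 ρ d Ξ Z).trans (hd.eq012 ..)
        · exact funext fun Ξ => funext fun Z => (nabla_toPre_003 ρ d Ξ Z).trans (hd.eq003 ..)
        · exact funext fun Ξ => funext fun Z => (nabla_toPre_111 ρ d Ξ Z).trans (hd.eq111 ..)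
        · exact funext fun Ξ => funext fun Z => (nabla_toPre_102 ρ d Ξ Z).trans (hd.eq102 ..)
        · exact funext fun Ξ => funext fun Z => (nabla_toPre_201 ρ d Ξ Z).trans (hd.eq201 ..)
      · exact nabla_snd_eq_zero ρ d.toPre_fst_eq_zero d.toPre_snd_eq_zero p q r hpq

/-- The family of functions given by a 1-cochain with components `l0`, `v` and `l1` in tridegrees
`(0, 1, 0)`, `(1, 0, 0)` and `(0, 0, 1)`. -/
def onePre (l0 : h →ₗ[𝕜] V) (l1 : g →ₗ[𝕜] W) (v : V) : PreCochain g h W V :=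
  (fun p q => match p, q with
    | 0, 1 => fun Y => l0 (Y 0).2
    | 1, 0 => fun _ => v
    | _, _ => 0,
  fun p q r => match p, q, r with
    | 0, 0, 0 => fun _ X => l1 (X 0)
    | _, _, _ => 0)

theorem onePre_fst_eq_zero (l0 : h →ₗ[𝕜] V) (l1 : g →ₗ[𝕜] W) (v : V) (p q : ℕ)
    (hpq : p + q ≠ 1) : (onePre l0 l1 v).1 p q = 0 := by
  rcases p with _ | _ | p <;> rcases q with _ | _ | q <;> first | rfl | omega

theorem onePre_snd_eq_zero (l0 : h →ₗ[𝕜] V) (l1 : g →ₗ[𝕜] W) (v : V) (p q r : ℕ)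
    (hpq : p + q + (r + 1) ≠ 1) : (onePre l0 l1 v).2 p q r = 0 := by
  rcases p with _ | p <;> rcases q with _ | q <;> rcases r with _ | r <;>
    first | rfl | omega

theorem onePre_mem (l0 : h →ₗ[𝕜] V) (l1 : g →ₗ[𝕜] W) (v : V) :
    onePre l0 l1 v ∈ Cochain 𝕜 g h W V 1 := by
  refine ⟨fun p q => ?_, fun p q r => ?_, onePre_fst_eq_zero l0 l1 v, onePre_snd_eq_zero l0 l1 v⟩
  · by_cases hpq : p + q = 1
    · obtain ⟨rfl, rfl⟩ | ⟨rfl, rfl⟩ : (p = 0 ∧ q = 1) ∨ (p = 1 ∧ q = 0) := by omega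
      · exact isAlternating_of_linear (A := Nerve g h 0) (l0 ∘ₗ LinearMap.snd 𝕜 (Fin 0 → g) h)
      · exact isAlternating_const _
    · rw [onePre_fst_eq_zero l0 l1 v p q hpq]; exact isAlternating_zero
  · by_cases hpq : p + q + (r + 1) = 1
    · obtain ⟨rfl, rfl, rfl⟩ : p = 0 ∧ q = 0 ∧ r = 0 := by omega
      exact ⟨fun Z => isAlternating_const _, fun Ξ => isAlternating_of_linear l1⟩
    · rw [onePre_snd_eq_zero l0 l1 v p q r hpq]; exact isAlternating_zero_curry

theorem exists_onePre_eq {c : PreCochain g h W V} (hc : c ∈ Cochain 𝕜 g h W V 1) :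
    ∃ (l0 : h →ₗ[𝕜] V) (l1 : g →ₗ[𝕜] W) (v : V), onePre l0 l1 v = c := by
  obtain ⟨h1, h2, h3, h4⟩ := hc
  obtain ⟨A, hA⟩ := (h1 0 1).exists_linear
  obtain ⟨B, hB⟩ := ((h2 0 0 0).2 Fin.elim0).exists_linear
  have e0 : ∀ ξ : Nerve g h 0, LinearMap.inr 𝕜 (Fin 0 → g) h ξ.2 = ξ :=
    fun ξ => Prod.ext (Subsingleton.elim _ _) rfl
  have cons1 : ∀ {A : Type u} (X : Fin 1 → A), (fun _ => X 0) = X := fun X =>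
    funext fun i => congrArg X (Subsingleton.elim _ _)
  refine ⟨A ∘ₗ LinearMap.inr 𝕜 (Fin 0 → g) h, B, c.1 1 0 Fin.elim0,
    Prod.ext (funext fun p => funext fun q => ?_)
    (funext fun p => funext fun q => funext fun r => ?_)⟩
  · by_cases hpq : p + q = 1
    · obtain ⟨rfl, rfl⟩ | ⟨rfl, rfl⟩ : (p = 0 ∧ q = 1) ∨ (p = 1 ∧ q = 0) := by omega
      · funext Y
        change A (LinearMap.inr 𝕜 (Fin 0 → g) h (Y 0).2) = _
        rw [e0, ← hA, cons1]
      · funext Y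
        exact congrArg (c.1 1 0) (Subsingleton.elim _ _)
    · rw [onePre_fst_eq_zero _ _ _ p q hpq, h3 p q hpq]
  · by_cases hpq : p + q + (r + 1) = 1
    · obtain ⟨rfl, rfl, rfl⟩ : p = 0 ∧ q = 0 ∧ r = 0 := by omega
      funext Y X
      change B (X 0) = _
      rw [← hB, cons1, Subsingleton.elim Y Fin.elim0]
    · rw [onePre_snd_eq_zero _ _ _ p q r hpq, h4 p q r hpq]

/-- The differential of a 1-cochain. -/
def oneDiff (ρ : TwoRep M phi) (l0 : h →ₗ[𝕜] V) (l1 : g →ₗ[𝕜] W) (v : V) :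
    TwoCochain 𝕜 g h W V where
  om0 := LinearMap.mk₂ 𝕜 (fun y₀ y₁ => ρ.onV y₀ (l0 y₁) - ρ.onV y₁ (l0 y₀) - l0 ⁅y₀, y₁⁆)
    (fun _ _ _ => by simp; abel) (fun _ _ _ => by simp [smul_sub])
    (fun _ _ _ => by simp; abel) (fun _ _ _ => by simp [smul_sub])
  al := LinearMap.mk₂ 𝕜 (fun y x => ρ.onW y (l1 x) - l1 (M.act y x) - ρ.one x (l0 y))
    (fun _ _ _ => by simp; abel) (fun _ _ _ => by simp [smul_sub])
    (fun _ _ _ => by simp; abel) (fun _ _ _ => by simp [smul_sub])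
  ph := l0 ∘ₗ (M.mu : g →ₗ[𝕜] h) - phi ∘ₗ l1 + ρ.onV.flip v ∘ₗ (M.mu : g →ₗ[𝕜] h)
  bh := ρ.onV.flip v
  om1 := LinearMap.mk₂ 𝕜
    (fun x₀ x₁ => ρ.onW (M.mu x₀) (l1 x₁) - ρ.onW (M.mu x₁) (l1 x₀) - l1 ⁅x₀, x₁⁆)
    (fun _ _ _ => by simp; abel) (fun _ _ _ => by simp [smul_sub])
    (fun _ _ _ => by simp; abel) (fun _ _ _ => by simp [smul_sub])
  lam := ρ.one.flip v
  u := v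
  om0_self := fun y => by simp
  om1_self := fun x => by simp

theorem nabla_onePre (ρ : TwoRep M phi) (l0 : h →ₗ[𝕜] V) (l1 : g →ₗ[𝕜] W) (v : V) :
    nabla ρ (onePre l0 l1 v) = (oneDiff ρ l0 l1 v).toPre := by
  have hfst := onePre_fst_eq_zero l0 l1 v
  have hsnd := onePre_snd_eq_zero l0 l1 v
  refine Prod.ext (funext fun p => funext fun q => ?_)
    (funext fun p => funext fun q => funext fun r => ?_)
  · by_cases hpq : p + q = 1 + 1
    · obtain ⟨rfl, rfl⟩ | ⟨rfl, rfl⟩ | ⟨rfl, rfl⟩ :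
        (p = 0 ∧ q = 2) ∨ (p = 1 ∧ q = 1) ∨ (p = 2 ∧ q = 0) := by omega
      · funext Ξ
        rw [nabla_fst_apply, deltaV, horizontalV, ceDiff_one, add_zero]
        simp only [finalTarget_zero]
        rfl
      · funext Ξ
        rw [nabla_fst_apply, deltaV, horizontalV, ceDiff_zero_deg, Fin.sum_univ_one]
        have h1 := differenceMap_zero_one M 0
          (fun Ξ' X => phi ((onePre l0 l1 v).2 0 0 0 Ξ' X)) Ξ
        refine (congrArg₂ (· + ·) rfl (congrArg₂ (· + ·) rfl (congrArg _ h1))).trans ?_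
        simp only [simplicialDiff_deg_zero, finalTarget_one]
        simp [onePre, oneDiff, TwoCochain.toPre, face]
        abel
      · funext Ξ
        rw [nabla_fst_apply, deltaV, horizontalV]
        simp only [simplicialDiff_deg_one]
        simp [onePre, oneDiff, TwoCochain.toPre]
    · rw [nabla_fst_eq_zero ρ hfst hsnd p q hpq, TwoCochain.toPre_fst_eq_zero _ p q hpq]
  · by_cases hpq : p + q + (r + 1) = 1 + 1
    · obtain ⟨rfl, rfl, rfl⟩ | ⟨rfl, rfl, rfl⟩ | ⟨rfl, rfl, rfl⟩ :
        (p = 0 ∧ q = 1 ∧ r = 0) ∨ (p = 0 ∧ q = 0 ∧ r = 1) ∨ (p = 1 ∧ q = 0 ∧ r = 0) := by omega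
      · funext Ξ Z
        rw [nabla_snd_apply, deltaW, deltaOne, horizontalW, ceDiff_zero_deg, add_zero]
        simp only [finalTarget_zero, repR_one, pow_one, neg_smul, one_smul, ← sub_eq_add_neg]
        rfl
      · funext Ξ Z
        rw [nabla_snd_apply, deltaW, deltaOne, horizontalW, ceDiff_one, add_zero, pow_zero,
          one_smul, zero_add]
        rfl
      · funext Ξ Z
        rw [nabla_snd_apply, deltaW, deltaOne, horizontalW]
        simp only [simplicialDiff_deg_zero]
        simp [onePre, oneDiff, TwoCochain.toPre]
    · rw [nabla_snd_eq_zero ρ hfst hsnd p q r hpq, TwoCochain.toPre_snd_eq_zero _ p q r hpq]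

theorem act_lie (M : CrossedModule 𝕜 g h) (y₀ y₁ : h) (x : g) :
    M.act ⁅y₀, y₁⁆ x = M.act y₀ (M.act y₁ x) - M.act y₁ (M.act y₀ x) := by
  rw [LieHom.map_lie]; exact LieDerivation.commutator_apply ..

theorem act_apply_lie (M : CrossedModule 𝕜 g h) (y : h) (x₀ x₁ : g) :
    M.act y ⁅x₀, x₁⁆ = ⁅M.act y x₀, x₁⁆ + ⁅x₀, M.act y x₁⁆ := by
  rw [LieDerivation.apply_lie_eq_add, add_comm]

/-- Jacobi solved for one of the three double brackets. Used at a fixed triple it removes the only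
relation among these terms, after which `abel` can compare them. -/
theorem jacobi_sum {L : Type u} [LieRing L] (a b c : L) :
    ⁅⁅a, b⁆, c⁆ = ⁅⁅a, c⁆, b⁆ - ⁅⁅b, c⁆, a⁆ := by
  rw [lie_lie, ← lie_skew ⁅a, c⁆ b, ← lie_skew ⁅b, c⁆ a]
  abel

/-- This is `∇² = 0` on 1-cochains. Each equation expands, by the axioms of `ρ` and of the crossed
module, into terms that cancel in pairs. -/
theorem oneDiff_isCocycle (ρ : TwoRep M phi) (l0 : h →ₗ[𝕜] V) (l1 : g →ₗ[𝕜] W) (v : V) :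
    (oneDiff ρ l0 l1 v).IsCocycle ρ where
  eq030 y₀ y₁ y₂ := by
    simp only [oneDiff, LinearMap.mk₂_apply, map_sub, ρ.onV_lie, jacobi_sum y₀ y₁ y₂]
    abel
  eq021 y₀ y₁ x := by
    simp only [oneDiff, LinearMap.mk₂_apply, map_sub, ρ.onW_lie, act_lie, ρ.one_act]
    abel
  eq012 y x₀ x₁ := by
    simp only [oneDiff, LinearMap.mk₂_apply, map_sub, act_apply_lie, map_add, ρ.onW_mu, ρ.one_lie,
      ρ.one_act, ρ.comm]
    abel
  eq003 x₀ x₁ x₂ := by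
    simp only [oneDiff, LinearMap.mk₂_apply, map_sub, jacobi_sum x₀ x₁ x₂, LieHom.map_lie,
      ρ.onW_lie]
    abel
  eq120 x₀ y₀ x₁ y₁ := by
    -- Equivariance produces brackets with `mu x₀` on the right; this brings the remaining one to
    -- that form.
    have hs : l0 ⁅M.mu x₀, y₁⁆ = -l0 ⁅y₁, M.mu x₀⁆ := by rw [← map_neg, lie_skew]
    simp [oneDiff, M.equivariance, ρ.onV_lie, ρ.comm, ρ.onV_mu, ρ.onW_mu, hs]
    abel
  eq111 x₀ y₀ x := by
    simp [oneDiff, ρ.one_act, ρ.one_lie, M.peiffer, ρ.onW_mu, ρ.onV_mu]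
    abel
  eq102 x₀ x₁ := by
    simp [oneDiff, ρ.onW_mu, ρ.one_lie]
  eq210 x₀ x₁ y := by
    simp [oneDiff, ρ.onV_mu]
    abel
  eq201 x := by simp [oneDiff]

theorem coboundaries_two_le_cocycles (ρ : TwoRep M phi) : coboundaries ρ 2 ≤ cocycles ρ 2 := by
  rintro _ ⟨c, hc, rfl⟩
  obtain ⟨l0, l1, v, rfl⟩ := exists_onePre_eq hc
  rw [nabla_onePre]
  exact ⟨TwoCochain.toPre_mem _, (nabla_toPre_eq_zero_iff ρ _).2 (oneDiff_isCocycle ρ l0 l1 v)⟩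

end OneCochains
-- The induced 2-representation and the cocycle of a splitting
section Induced

variable {𝕜 : Type v} [Field 𝕜] {g h W V : Type u}
  [LieRing g] [LieAlgebra 𝕜 g] [LieRing h] [LieAlgebra 𝕜 h]
  [AddCommGroup W] [Module 𝕜 W] [AddCommGroup V] [Module 𝕜 V]
  {M : CrossedModule 𝕜 g h} {phi : W →ₗ[𝕜] V}

/-- The counterpart of `jacobi_sum` for brackets nested on the right. -/
theorem lie_rotate {L : Type u} [LieRing L] (a b c : L) :
    ⁅a, ⁅b, c⁆⁆ = ⁅b, ⁅a, c⁆⁆ - ⁅c, ⁅a, b⁆⁆ := by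
  rw [leibniz_lie a b c, ← lie_skew ⁅a, b⁆ c]
  abel

namespace Extension

variable (E : Extension M phi)

theorem nonempty_splitting : Nonempty E.Splitting := by
  obtain ⟨s₁, h₁⟩ := (E.π₁ : E.e₁ →ₗ[𝕜] g).exists_rightInverse_of_surjective
    (LinearMap.range_eq_top.2 E.π₁_surjective)
  obtain ⟨s₀, h₀⟩ := (E.π₀ : E.e₀ →ₗ[𝕜] h).exists_rightInverse_of_surjective
    (LinearMap.range_eq_top.2 E.π₀_surjective)
  exact ⟨⟨s₁, s₀, fun x => LinearMap.congr_fun h₁ x, fun y => LinearMap.congr_fun h₀ y⟩⟩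

theorem exists_retraction₁ : ∃ r : E.e₁ →ₗ[𝕜] W, ∀ e, E.π₁ e = 0 → E.j₁ (r e) = e := by
  obtain ⟨r, hr⟩ := E.j₁.exists_leftInverse_of_injective (LinearMap.ker_eq_bot.2 E.j₁_injective)
  refine ⟨r, fun e he => ?_⟩
  obtain ⟨w, rfl⟩ := (E.exact₁ e).1 he
  exact congrArg E.j₁ (LinearMap.congr_fun hr w)

theorem exists_retraction₀ : ∃ r : E.e₀ →ₗ[𝕜] V, ∀ e, E.π₀ e = 0 → E.j₀ (r e) = e := by
  obtain ⟨r, hr⟩ := E.j₀.exists_leftInverse_of_injective (LinearMap.ker_eq_bot.2 E.j₀_injective)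
  refine ⟨r, fun e he => ?_⟩
  obtain ⟨v, rfl⟩ := (E.exact₀ e).1 he
  exact congrArg E.j₀ (LinearMap.congr_fun hr v)

theorem π₁_j₁ (w : W) : E.π₁ (E.j₁ w) = 0 := (E.exact₁ _).2 ⟨w, rfl⟩

theorem π₀_j₀ (v : V) : E.π₀ (E.j₀ v) = 0 := (E.exact₀ _).2 ⟨v, rfl⟩

/-- By exactness `f - f'` comes from `V`, whose bracket is zero. This lemma and its two analogues
are why the induced 2-representation does not depend on the splitting. -/
theorem lie_j₀_congr {f f' : E.e₀} (hf : E.π₀ f = E.π₀ f') (v : V) :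
    ⁅f, E.j₀ v⁆ = ⁅f', E.j₀ v⁆ := by
  obtain ⟨v', hv'⟩ := (E.exact₀ (f - f')).1 (by rw [map_sub, hf, sub_self])
  rw [← sub_eq_zero, ← sub_lie, ← hv', E.j₀_lie]

theorem act_j₁_congr {f f' : E.e₀} (hf : E.π₀ f = E.π₀ f') (w : W) :
    E.eps.act f (E.j₁ w) = E.eps.act f' (E.j₁ w) := by
  obtain ⟨v', hv'⟩ := (E.exact₀ (f - f')).1 (by rw [map_sub, hf, sub_self])
  rw [← sub_eq_zero, ← LieDerivation.sub_apply, ← map_sub, ← hv', E.act_j]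

theorem act_j₀_congr {e e' : E.e₁} (he : E.π₁ e = E.π₁ e') (v : V) :
    E.eps.act (E.j₀ v) e = E.eps.act (E.j₀ v) e' := by
  obtain ⟨w, hw⟩ := (E.exact₁ (e - e')).1 (by rw [map_sub, he, sub_self])
  rw [← sub_eq_zero, ← map_sub, ← hw, E.act_j]

/-- `ρ` describes the action of the extension on its kernel. -/
structure ActsBy (ρ : TwoRep M phi) : Prop where
  onV : ∀ f v, E.j₀ (ρ.onV (E.π₀ f) v) = ⁅f, E.j₀ v⁆
  onW : ∀ f w, E.j₁ (ρ.onW (E.π₀ f) w) = E.eps.act f (E.j₁ w)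
  one : ∀ e v, E.j₁ (ρ.one (E.π₁ e) v) = -E.eps.act (E.j₀ v) e

theorem exists_actsBy : ∃ ρ : TwoRep M phi, E.ActsBy ρ := by
  obtain ⟨σ⟩ := E.nonempty_splitting
  obtain ⟨r₁, hr₁⟩ := E.exists_retraction₁
  obtain ⟨r₀, hr₀⟩ := E.exists_retraction₀
  let onV : h →ₗ[𝕜] Module.End 𝕜 V := LinearMap.mk₂ 𝕜 (fun y v => r₀ ⁅σ.σ₀ y, E.j₀ v⁆)
    (fun _ _ _ => by simp) (fun _ _ _ => by simp) (fun _ _ _ => by simp) (fun _ _ _ => by simp)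
  let onW : h →ₗ[𝕜] Module.End 𝕜 W := LinearMap.mk₂ 𝕜 (fun y w => r₁ (E.eps.act (σ.σ₀ y) (E.j₁ w)))
    (fun _ _ _ => by simp) (fun _ _ _ => by simp) (fun _ _ _ => by simp) (fun _ _ _ => by simp)
  let one : g →ₗ[𝕜] (V →ₗ[𝕜] W) :=
    LinearMap.mk₂ 𝕜 (fun x v => r₁ (-E.eps.act (E.j₀ v) (σ.σ₁ x)))
    (fun _ _ _ => by simp; abel) (fun _ _ _ => by simp) (fun _ _ _ => by simp; abel)
    (fun _ _ _ => by simp)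
  -- The formulas are proved for arbitrary elements of the extension, not only for those in the
  -- image of `σ`. Each axiom of a 2-representation can then be checked on arbitrary lifts, where it
  -- becomes an identity of the crossed module `E.eps`.
  have hV : ∀ f v, E.j₀ (onV (E.π₀ f) v) = ⁅f, E.j₀ v⁆ := fun f v =>
    (hr₀ _ (by rw [LieHom.map_lie, E.π₀_j₀, lie_zero])).trans (E.lie_j₀_congr (σ.π₀_σ₀ _) v)
  have hW : ∀ f w, E.j₁ (onW (E.π₀ f) w) = E.eps.act f (E.j₁ w) := fun f w =>
    (hr₁ _ (by rw [E.π₁_act, E.π₁_j₁, map_zero])).trans (E.act_j₁_congr (σ.π₀_σ₀ _) w)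
  have h1 : ∀ e v, E.j₁ (one (E.π₁ e) v) = -E.eps.act (E.j₀ v) e := fun e v =>
    (hr₁ _ (by simp [E.π₁_act, E.π₀_j₀])).trans
      (congrArg _ (E.act_j₀_congr (σ.π₁_σ₁ _) v))
  -- Since `j₀ (phi w)` is the image of `j₁ w` under the structure map, this is the Peiffer
  -- identity.
  have h0 : ∀ e w, E.eps.act (E.j₀ (phi w)) e = ⁅E.j₁ w, e⁆ := fun e w => by
    rw [← E.eps_j₁, E.eps.peiffer]
  refine ⟨{ onW := onW, onV := onV, one := one, onW_lie := ?_, onV_lie := ?_, comm := ?_,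
            one_lie := ?_, onW_mu := ?_, onV_mu := ?_, one_act := ?_ }, ⟨hV, hW, h1⟩⟩
  · intro y₀ y₁ w
    obtain ⟨f₀, rfl⟩ := E.π₀_surjective y₀
    obtain ⟨f₁, rfl⟩ := E.π₀_surjective y₁
    apply E.j₁_injective
    rw [← LieHom.map_lie, map_sub, hW, hW, hW, hW, hW, act_lie]
  · intro y₀ y₁ v
    obtain ⟨f₀, rfl⟩ := E.π₀_surjective y₀
    obtain ⟨f₁, rfl⟩ := E.π₀_surjective y₁
    apply E.j₀_injective
    rw [← LieHom.map_lie, map_sub, hV, hV, hV, hV, hV, lie_lie]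
  · intro y w
    obtain ⟨f, rfl⟩ := E.π₀_surjective y
    apply E.j₀_injective
    rw [hV, ← E.eps_j₁, ← E.eps_j₁, hW, E.eps.equivariance]
  · intro x₀ x₁ v
    obtain ⟨e₀, rfl⟩ := E.π₁_surjective x₀
    obtain ⟨e₁, rfl⟩ := E.π₁_surjective x₁
    apply E.j₁_injective
    rw [← LieHom.map_lie, map_sub, h1, h1, h1, h0, h0, h1, h1, act_apply_lie, neg_lie,
      neg_lie, ← lie_skew e₀]
    abel
  · intro x w
    obtain ⟨e, rfl⟩ := E.π₁_surjective x
    apply E.j₁_injective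
    rw [← E.π₀_eps, hW, h1, h0, E.eps.peiffer, lie_skew]
  · intro x v
    obtain ⟨e, rfl⟩ := E.π₁_surjective x
    apply E.j₀_injective
    rw [← E.π₀_eps, hV, ← E.eps_j₁, h1, map_neg, E.eps.equivariance, lie_skew]
  · intro y x v
    obtain ⟨f, rfl⟩ := E.π₀_surjective y
    obtain ⟨e, rfl⟩ := E.π₁_surjective x
    apply E.j₁_injective
    rw [← E.π₁_act, map_sub, h1, hW, h1, h1, hV, act_lie, map_neg]
    abel

variable {E}

theorem ActsBy.inducesAlong {ρ : TwoRep M phi} (hρ : E.ActsBy ρ) (σ : E.Splitting) :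
    E.InducesAlong σ ρ := by
  refine ⟨fun y v => ?_, fun y w => ?_, fun x v => ?_⟩
  · rw [← hρ.onV, σ.π₀_σ₀]
  · rw [← hρ.onW, σ.π₀_σ₀]
  · rw [← hρ.one, σ.π₁_σ₁]

/-- An element and the lift `σ` of its projection act equally on the kernel, so one splitting
already determines the whole action. -/
theorem InducesAlong.actsBy {σ : E.Splitting} {ρ : TwoRep M phi} (hρ : E.InducesAlong σ ρ) :
    E.ActsBy ρ where
  onV _ v := (hρ.1 _ _).trans (E.lie_j₀_congr (σ.π₀_σ₀ _) v)
  onW _ w := (hρ.2.1 _ _).trans (E.act_j₁_congr (σ.π₀_σ₀ _) w)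
  one _ v := (hρ.2.2 _ _).trans (congrArg _ (E.act_j₀_congr (σ.π₁_σ₁ _) v))

theorem ActsBy.unique {ρ ρ' : TwoRep M phi} (hρ : E.ActsBy ρ) (hρ' : E.ActsBy ρ') : ρ' = ρ := by
  refine TwoRep.ext ?_ ?_ ?_
  · ext y w
    obtain ⟨f, rfl⟩ := E.π₀_surjective y
    exact E.j₁_injective ((hρ'.onW f w).trans (hρ.onW f w).symm)
  · ext y v
    obtain ⟨f, rfl⟩ := E.π₀_surjective y
    exact E.j₀_injective ((hρ'.onV f v).trans (hρ.onV f v).symm)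
  · ext x v
    obtain ⟨e, rfl⟩ := E.π₁_surjective x
    exact E.j₁_injective ((hρ'.one e v).trans (hρ.one e v).symm)

variable (E)

theorem exists_unique_induced : ∃ ρ : TwoRep M phi, E.Induces ρ ∧
    ∀ (σ : E.Splitting) (ρ' : TwoRep M phi), E.InducesAlong σ ρ' ↔ ρ' = ρ := by
  obtain ⟨ρ, hρ⟩ := E.exists_actsBy
  obtain ⟨σ⟩ := E.nonempty_splitting
  refine ⟨ρ, ⟨σ, hρ.inducesAlong σ⟩, fun σ' ρ' => ⟨fun hρ' => hρ.unique hρ'.actsBy, ?_⟩⟩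
  rintro rfl
  exact hρ.inducesAlong σ'

/-- The components of the 2-cochain of a splitting. -/
structure HasCochain (σ : E.Splitting) (d : TwoCochain 𝕜 g h W V) : Prop where
  om0 : ∀ y₀ y₁, E.j₀ (d.om0 y₀ y₁) = σ.σ₀ ⁅y₀, y₁⁆ - ⁅σ.σ₀ y₀, σ.σ₀ y₁⁆
  al : ∀ y x, E.j₁ (d.al y x) = σ.σ₁ (M.act y x) - E.eps.act (σ.σ₀ y) (σ.σ₁ x)
  ph : ∀ x, E.j₀ (d.ph x) = E.eps.mu (σ.σ₁ x) - σ.σ₀ (M.mu x)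
  om1 : ∀ x₀ x₁, E.j₁ (d.om1 x₀ x₁) = σ.σ₁ ⁅x₀, x₁⁆ - ⁅σ.σ₁ x₀, σ.σ₁ x₁⁆
  bh : d.bh = 0
  lam : d.lam = 0
  u : d.u = 0

/-- The projections are morphisms and `σ` is a section, so the four defects are killed by `π` and
come from the kernel. Linear retractions of `j₁` and `j₀` turn them into linear maps. -/
theorem exists_hasCochain (σ : E.Splitting) : ∃ d, E.HasCochain σ d := by
  obtain ⟨r₁, hr₁⟩ := E.exists_retraction₁
  obtain ⟨r₀, hr₀⟩ := E.exists_retraction₀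
  refine ⟨{
    om0 := LinearMap.mk₂ 𝕜 (fun y₀ y₁ => r₀ (σ.σ₀ ⁅y₀, y₁⁆ - ⁅σ.σ₀ y₀, σ.σ₀ y₁⁆))
      (fun _ _ _ => by simp; abel) (fun _ _ _ => by simp [smul_sub])
      (fun _ _ _ => by simp; abel) (fun _ _ _ => by simp [smul_sub])
    al := LinearMap.mk₂ 𝕜 (fun y x => r₁ (σ.σ₁ (M.act y x) - E.eps.act (σ.σ₀ y) (σ.σ₁ x)))
      (fun _ _ _ => by simp; abel) (fun _ _ _ => by simp [smul_sub])
      (fun _ _ _ => by simp; abel) (fun _ _ _ => by simp [smul_sub])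
    ph := r₀ ∘ₗ ((E.eps.mu : E.e₁ →ₗ[𝕜] E.e₀) ∘ₗ σ.σ₁ - σ.σ₀ ∘ₗ (M.mu : g →ₗ[𝕜] h))
    bh := 0
    om1 := LinearMap.mk₂ 𝕜 (fun x₀ x₁ => r₁ (σ.σ₁ ⁅x₀, x₁⁆ - ⁅σ.σ₁ x₀, σ.σ₁ x₁⁆))
      (fun _ _ _ => by simp; abel) (fun _ _ _ => by simp [smul_sub])
      (fun _ _ _ => by simp; abel) (fun _ _ _ => by simp [smul_sub])
    lam := 0
    u := 0
    om0_self := fun y => by simp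
    om1_self := fun x => by simp }, ?_⟩
  exact
    { om0 := fun y₀ y₁ => hr₀ _ (by simp [σ.π₀_σ₀])
      al := fun y x => hr₁ _ (by simp [σ.π₁_σ₁, E.π₁_act, σ.π₀_σ₀])
      ph := fun x => hr₀ _ (by simp [σ.π₁_σ₁, E.π₀_eps, σ.π₀_σ₀])
      om1 := fun x₀ x₁ => hr₁ _ (by simp [σ.π₁_σ₁])
      bh := rfl
      lam := rfl
      u := rfl }

variable {E}

theorem HasCochain.isCochainOf {σ : E.Splitting} {d : TwoCochain 𝕜 g h W V}
    (hd : E.HasCochain σ d) : E.IsCochainOf σ d.toPre := by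
  refine ⟨d.toPre_mem, fun Y => hd.om0 _ _, fun Y X => hd.al _ _, fun ξ => ?_,
    fun Y X => hd.om1 _ _, ?_, ?_⟩
  · refine (congrArg E.j₀ ?_).trans (hd.ph _)
    simp [TwoCochain.toPre, hd.bh]
  · funext Y X
    simp [TwoCochain.toPre, hd.lam]
  · funext Y
    simp [TwoCochain.toPre, hd.u]

/-- After applying the injective `j`, each equation reflects axioms of `E.eps`: Jacobi in `e₀` (030)
and in `e₁` (003), compatibility of the action with brackets (021), the derivation property (012),
equivariance and bracket preservation of the structure map (120), Peiffer (111). The last three hold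
because `bh`, `lam` and `u` vanish. -/
theorem HasCochain.isCocycle {ρ : TwoRep M phi} (hρ : E.ActsBy ρ) {σ : E.Splitting}
    {d : TwoCochain 𝕜 g h W V} (hd : E.HasCochain σ d) : d.IsCocycle ρ := by
  have hV : ∀ y v, E.j₀ (ρ.onV y v) = ⁅σ.σ₀ y, E.j₀ v⁆ := (hρ.inducesAlong σ).1
  have hW : ∀ y w, E.j₁ (ρ.onW y w) = E.eps.act (σ.σ₀ y) (E.j₁ w) := (hρ.inducesAlong σ).2.1
  have h1 : ∀ x v, E.j₁ (ρ.one x v) = -E.eps.act (E.j₀ v) (σ.σ₁ x) := (hρ.inducesAlong σ).2.2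
  -- Both `E.eps.mu (σ.σ₁ x)` and `σ.σ₀ (M.mu x)` lift `M.mu x`; the former gives access to the
  -- Peiffer identity and equivariance.
  have hVmu : ∀ x v, E.j₀ (ρ.onV (M.mu x) v) = ⁅E.eps.mu (σ.σ₁ x), E.j₀ v⁆ := fun x v => by
    rw [← hρ.onV, E.π₀_eps, σ.π₁_σ₁]
  have hWmu : ∀ x w, E.j₁ (ρ.onW (M.mu x) w) = ⁅σ.σ₁ x, E.j₁ w⁆ := fun x w => by
    rw [← E.eps.peiffer, ← hρ.onW, E.π₀_eps, σ.π₁_σ₁]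
  refine ⟨fun y₀ y₁ y₂ => E.j₀_injective ?_, fun y₀ y₁ x => E.j₁_injective ?_,
    fun y x₀ x₁ => E.j₁_injective ?_, fun x₀ x₁ x₂ => E.j₁_injective ?_,
    fun x₀ y₀ x₁ y₁ => E.j₀_injective ?_, fun x₀ y₀ x => E.j₁_injective ?_, ?_, ?_, ?_⟩
  · simp only [map_add, map_sub, hV, hd.om0, lie_sub, jacobi_sum y₀ y₁ y₂, map_zero]
    rw [← lie_skew (σ.σ₀ ⁅y₀, y₁⁆), ← lie_skew (σ.σ₀ ⁅y₀, y₂⁆), ← lie_skew (σ.σ₀ ⁅y₁, y₂⁆),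
      lie_rotate (σ.σ₀ y₀)]
    abel
  · simp only [map_add, map_sub, hW, h1, hd.om0, hd.al, map_zero, act_lie,
      LieDerivation.sub_apply]
    abel
  -- `hWmu` must come before `hW`, which would also match `ρ.onW (M.mu x)` and produce the other
  -- lift.
  · simp only [map_sub, hWmu]
    simp only [map_add, map_sub, hW, hd.om1, hd.al, map_zero, act_apply_lie, lie_sub]
    rw [← lie_skew (σ.σ₁ x₁) (σ.σ₁ (M.act y x₀)),
      ← lie_skew (σ.σ₁ x₁) (E.eps.act (σ.σ₀ y) (σ.σ₁ x₀))]
    abel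
  · simp only [map_add, map_sub, hWmu, hd.om1, lie_sub, jacobi_sum x₀ x₁ x₂, map_zero]
    rw [← lie_skew (σ.σ₁ ⁅x₀, x₁⁆), ← lie_skew (σ.σ₁ ⁅x₀, x₂⁆), ← lie_skew (σ.σ₁ ⁅x₁, x₂⁆),
      lie_rotate (σ.σ₁ x₀)]
    abel
  -- Only `mu x₁` is lifted through `E.eps.mu ∘ σ₁`, while `mu x₀` is lifted through `σ₀`; with this
  -- choice the mixed brackets cancel.
  · simp only [hd.bh, LinearMap.zero_apply, add_zero, map_add, LinearMap.add_apply, map_sub,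
      hVmu x₁]
    simp only [map_sub, hV, hd.om0, hd.ph, hd.al, hd.om1, ← E.eps_j₁, M.equivariance,
      E.eps.equivariance, LieHom.map_lie, lie_sub, map_zero]
    rw [← lie_skew (E.eps.mu (σ.σ₁ x₁)) (E.eps.mu (σ.σ₁ x₀)),
      ← lie_skew (E.eps.mu (σ.σ₁ x₁)) (σ.σ₀ (M.mu x₀)),
      ← lie_skew (σ.σ₀ (M.mu x₀)) (σ.σ₀ y₁), ← lie_skew (M.mu x₀) y₁, map_neg]
    abel
  · simp only [hd.bh, hd.lam, LinearMap.zero_apply, add_zero, map_add, LinearMap.add_apply,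
      map_sub, h1, hd.ph, hd.al, hd.om1, LieDerivation.sub_apply, E.eps.peiffer, M.peiffer,
      map_zero]
    abel
  · intro x₀ x₁; simp [hd.lam]
  · intro x₀ x₁ y; simp [hd.bh, hd.lam, hd.u]
  · intro x; simp [hd.lam, hd.u]

end Extension
end Induced
-- The extension built from a normalized cocycle
section Total

variable {𝕜 : Type v} [Field 𝕜] {g h W V : Type u}
  [LieRing g] [LieAlgebra 𝕜 g] [LieRing h] [LieAlgebra 𝕜 h]
  [AddCommGroup W] [Module 𝕜 W] [AddCommGroup V] [Module 𝕜 V]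
  {M : CrossedModule 𝕜 g h} {phi : W →ₗ[𝕜] V}

/-- Polarization of `om0_self`, valid in every characteristic. -/
theorem TwoCochain.om0_skew (d : TwoCochain 𝕜 g h W V) (y₀ y₁ : h) :
    d.om0 y₁ y₀ = -d.om0 y₀ y₁ := by
  have := d.om0_self (y₀ + y₁)
  simp only [map_add, LinearMap.add_apply, d.om0_self, zero_add, add_zero] at this
  exact eq_neg_of_add_eq_zero_left this

theorem TwoCochain.om1_skew (d : TwoCochain 𝕜 g h W V) (x₀ x₁ : g) :
    d.om1 x₁ x₀ = -d.om1 x₀ x₁ := by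
  have := d.om1_self (x₀ + x₁)
  simp only [map_add, LinearMap.add_apply, d.om1_self, zero_add, add_zero] at this
  exact eq_neg_of_add_eq_zero_left this

/-- The Lie ring structure on `V × h` twisted by a cocycle. -/
@[reducible] def totalLieRing₀ (ρ : TwoRep M phi) (d : TwoCochain 𝕜 g h W V)
    (hd : d.IsCocycle ρ) : LieRing (V × h) where
  -- The formula is forced by reading `(v, y)` as `j₀ v + σ₀ y`; the minus sign is that of `[σ₀ y₀,
  -- σ₀ y₁] = σ₀[y₀, y₁] - ω₀(y₀, y₁)`.
  bracket a b := (ρ.onV a.2 b.1 - ρ.onV b.2 a.1 - d.om0 a.2 b.2, ⁅a.2, b.2⁆)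
  add_lie a b c := Prod.ext (by simp; abel) (by simp)
  lie_add a b c := Prod.ext (by simp; abel) (by simp)
  lie_self a := Prod.ext (by simp [d.om0_self]) (by simp)
  leibniz_lie a b c := by
    refine Prod.ext ?_ (leibniz_lie a.2 b.2 c.2)
    have h := hd.eq030 a.2 b.2 c.2
    rw [← sub_eq_zero]
    simp only [map_sub, ρ.onV_lie, Prod.fst_add]
    rw [d.om0_skew ⁅b.2, c.2⁆ a.2, d.om0_skew ⁅a.2, c.2⁆ b.2, ← neg_eq_zero, ← h]
    abel

/-- The Lie algebra structure on `V × h` twisted by a cocycle. -/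
@[reducible] def totalLieAlgebra₀ (ρ : TwoRep M phi) (d : TwoCochain 𝕜 g h W V)
    (hd : d.IsCocycle ρ) : @LieAlgebra 𝕜 (V × h) _ (totalLieRing₀ ρ d hd) :=
  letI := totalLieRing₀ ρ d hd
  { (inferInstance : Module 𝕜 (V × h)) with
    lie_smul := fun t a b => by
      refine Prod.ext ?_ (lie_smul t a.2 b.2)
      change ρ.onV a.2 (t • b.1) - ρ.onV (t • b.2) a.1 - d.om0 a.2 (t • b.2) =
        t • (ρ.onV a.2 b.1 - ρ.onV b.2 a.1 - d.om0 a.2 b.2)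
      simp [smul_sub] }

/-- The Lie ring structure on `W × g` twisted by a cocycle. -/
@[reducible] def totalLieRing₁ (ρ : TwoRep M phi) (d : TwoCochain 𝕜 g h W V)
    (hd : d.IsCocycle ρ) : LieRing (W × g) where
  -- By Peiffer, bracketing with a lift of `x` acts on `W` through `mu x`.
  bracket a b := (ρ.onW (M.mu a.2) b.1 - ρ.onW (M.mu b.2) a.1 - d.om1 a.2 b.2, ⁅a.2, b.2⁆)
  add_lie a b c := Prod.ext (by simp; abel) (by simp)
  lie_add a b c := Prod.ext (by simp; abel) (by simp)
  lie_self a := Prod.ext (by simp [d.om1_self]) (by simp)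
  leibniz_lie a b c := by
    refine Prod.ext ?_ (leibniz_lie a.2 b.2 c.2)
    have h := hd.eq003 a.2 b.2 c.2
    rw [← sub_eq_zero]
    simp only [map_sub, LieHom.map_lie, ρ.onW_lie, Prod.fst_add]
    rw [d.om1_skew ⁅b.2, c.2⁆ a.2, d.om1_skew ⁅a.2, c.2⁆ b.2, ← neg_eq_zero, ← h]
    abel

/-- The Lie algebra structure on `W × g` twisted by a cocycle. -/
@[reducible] def totalLieAlgebra₁ (ρ : TwoRep M phi) (d : TwoCochain 𝕜 g h W V)
    (hd : d.IsCocycle ρ) : @LieAlgebra 𝕜 (W × g) _ (totalLieRing₁ ρ d hd) :=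
  letI := totalLieRing₁ ρ d hd
  { (inferInstance : Module 𝕜 (W × g)) with
    lie_smul := fun t a b => by
      refine Prod.ext ?_ (lie_smul t a.2 b.2)
      change ρ.onW (M.mu a.2) (t • b.1) - ρ.onW (M.mu (t • b.2)) a.1 - d.om1 a.2 (t • b.2) =
        t • (ρ.onW (M.mu a.2) b.1 - ρ.onW (M.mu b.2) a.1 - d.om1 a.2 b.2)
      simp [smul_sub] }

/-- The (1,1,1) equation at `y₀ = 0`. It is what the Peiffer identity of the total crossed module
requires. -/
theorem TwoCochain.IsCocycle.om1_eq {ρ : TwoRep M phi} {d : TwoCochain 𝕜 g h W V}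
    (hd : d.IsCocycle ρ) (hb : d.bh = 0) (hl : d.lam = 0) (x₀ x : g) :
    d.om1 x₀ x = d.al (M.mu x₀) x + ρ.one x (d.ph x₀) := by
  have h := hd.eq111 x₀ 0 x
  simp only [hb, hl, LinearMap.zero_apply, map_zero, add_zero, zero_add, sub_self, zero_sub] at h
  rw [← sub_eq_zero, ← h]
  abel

/-- The (1,2,0) equation at `x₀ = 0`, `y₁ = 0`. It is what equivariance of the total crossed module
requires. -/
theorem TwoCochain.IsCocycle.ph_act {ρ : TwoRep M phi} {d : TwoCochain 𝕜 g h W V}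
    (hd : d.IsCocycle ρ) (hb : d.bh = 0) (y : h) (x : g) :
    d.ph (M.act y x) = ρ.onV y (d.ph x) - d.om0 y (M.mu x) + phi (d.al y x) := by
  have h := hd.eq120 0 y x 0
  simp only [hb, LinearMap.zero_apply, map_zero, add_zero, zero_add, sub_zero, zero_sub, zero_lie,
    sub_neg_eq_add] at h
  rw [← sub_eq_zero, ← neg_eq_zero, ← h]
  abel

/-- The crossed module `W × g → V × h` twisted by a cocycle. -/
@[reducible] def totalCrossedModule (ρ : TwoRep M phi) (d : TwoCochain 𝕜 g h W V)
    (hd : d.IsCocycle ρ) (hb : d.bh = 0) (hl : d.lam = 0) :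
    letI := totalLieRing₀ ρ d hd
    letI := totalLieAlgebra₀ ρ d hd
    letI := totalLieRing₁ ρ d hd
    letI := totalLieAlgebra₁ ρ d hd
    CrossedModule 𝕜 (W × g) (V × h) :=
  letI := totalLieRing₀ ρ d hd
  letI := totalLieAlgebra₀ ρ d hd
  letI := totalLieRing₁ ρ d hd
  letI := totalLieAlgebra₁ ρ d hd
  { mu :=
      { toFun := fun a => (phi a.1 + d.ph a.2, M.mu a.2)
        map_add' := fun a b => Prod.ext (by simp; abel) (by simp)
        map_smul' := fun t a => Prod.ext (by simp) (by simp)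
        map_lie' := by
          intro a b
          refine Prod.ext ?_ (LieHom.map_lie _ _ _)
          change phi (ρ.onW (M.mu a.2) b.1 - ρ.onW (M.mu b.2) a.1 - d.om1 a.2 b.2) +
            d.ph ⁅a.2, b.2⁆ = ρ.onV (M.mu a.2) (phi b.1 + d.ph b.2) -
            ρ.onV (M.mu b.2) (phi a.1 + d.ph a.2) - d.om0 (M.mu a.2) (M.mu b.2)
          -- Once the bracket of `g` is written as an action, preservation of brackets follows from
          -- the relations behind equivariance and Peiffer.
          rw [← M.peiffer, hd.ph_act hb, hd.om1_eq hb hl]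
          simp only [map_sub, map_add, ρ.comm, ρ.onV_mu b.2 (d.ph a.2)]
          abel }
    act :=
      { toFun := fun f =>
          -- This is the action of `j₀ v + σ₀ y` on `j₁ w + σ₁ x`: `V` acts on `σ₁ x` by `-ρ₁(x)`,
          -- and `α` measures the failure of `σ` to respect the action.
          { toFun := fun e => (ρ.onW f.2 e.1 - ρ.one e.2 f.1 - d.al f.2 e.2, M.act f.2 e.2)
            map_add' := fun a b => Prod.ext (by simp; abel) (by simp)
            map_smul' := fun t a => Prod.ext (by simp [smul_sub]) (by simp)
            leibniz' := fun a b => by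
              refine Prod.ext ?_ (LieDerivation.apply_lie_eq_sub _ _ _)
              change ρ.onW f.2 (ρ.onW (M.mu a.2) b.1 - ρ.onW (M.mu b.2) a.1 - d.om1 a.2 b.2) -
                ρ.one ⁅a.2, b.2⁆ f.1 - d.al f.2 ⁅a.2, b.2⁆ =
                (ρ.onW (M.mu a.2) (ρ.onW f.2 b.1 - ρ.one b.2 f.1 - d.al f.2 b.2) -
                  ρ.onW (M.mu (M.act f.2 b.2)) a.1 - d.om1 a.2 (M.act f.2 b.2)) -
                (ρ.onW (M.mu b.2) (ρ.onW f.2 a.1 - ρ.one a.2 f.1 - d.al f.2 a.2) -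
                  ρ.onW (M.mu (M.act f.2 a.2)) b.1 - d.om1 b.2 (M.act f.2 a.2))
              have h := hd.eq012 f.2 a.2 b.2
              rw [← sub_eq_zero, ← neg_eq_zero, ← h, d.om1_skew _ b.2]
              simp only [map_sub, M.equivariance, ρ.onW_lie, ρ.one_lie,
                ρ.onW_mu _ (ρ.one _ _)]
              abel }
        map_add' := fun f f' => LieDerivation.ext fun e =>
          Prod.ext (by simp; abel) (by simp)
        map_smul' := fun t f => LieDerivation.ext fun e =>
          Prod.ext (by simp [smul_sub]) (by simp)
        map_lie' := by
          intro f f'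
          refine LieDerivation.ext fun e => ?_
          rw [LieDerivation.commutator_apply]
          refine Prod.ext ?_ (act_lie M _ _ _)
          change ρ.onW ⁅f.2, f'.2⁆ e.1 -
              ρ.one e.2 (ρ.onV f.2 f'.1 - ρ.onV f'.2 f.1 - d.om0 f.2 f'.2) -
              d.al ⁅f.2, f'.2⁆ e.2 =
            (ρ.onW f.2 (ρ.onW f'.2 e.1 - ρ.one e.2 f'.1 - d.al f'.2 e.2) -
              ρ.one (M.act f'.2 e.2) f.1 - d.al f.2 (M.act f'.2 e.2)) -
            (ρ.onW f'.2 (ρ.onW f.2 e.1 - ρ.one e.2 f.1 - d.al f.2 e.2) -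
              ρ.one (M.act f.2 e.2) f'.1 - d.al f'.2 (M.act f.2 e.2))
          have h := hd.eq021 f.2 f'.2 e.2
          rw [← sub_eq_zero, ← h]
          simp only [map_sub, ρ.onW_lie, ρ.one_act]
          abel }
    equivariance := fun f e => by
      refine Prod.ext ?_ (M.equivariance _ _)
      change phi (ρ.onW f.2 e.1 - ρ.one e.2 f.1 - d.al f.2 e.2) + d.ph (M.act f.2 e.2) =
        ρ.onV f.2 (phi e.1 + d.ph e.2) - ρ.onV (M.mu e.2) f.1 - d.om0 f.2 (M.mu e.2)
      simp only [map_sub, map_add, ρ.comm, ρ.onV_mu, hd.ph_act hb]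
      abel
    peiffer := fun a b => by
      refine Prod.ext ?_ (M.peiffer _ _)
      change ρ.onW (M.mu a.2) b.1 - ρ.one b.2 (phi a.1 + d.ph a.2) - d.al (M.mu a.2) b.2 =
        ρ.onW (M.mu a.2) b.1 - ρ.onW (M.mu b.2) a.1 - d.om1 a.2 b.2
      rw [hd.om1_eq hb hl, map_add, ρ.onW_mu b.2]
      abel }

/-- The extension determined by a cocycle. -/
def totalExtension (ρ : TwoRep M phi) (d : TwoCochain 𝕜 g h W V)
    (hd : d.IsCocycle ρ) (hb : d.bh = 0) (hl : d.lam = 0) : Extension M phi :=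
  letI := totalLieRing₀ ρ d hd
  letI := totalLieAlgebra₀ ρ d hd
  letI := totalLieRing₁ ρ d hd
  letI := totalLieAlgebra₁ ρ d hd
  { e₁ := W × g
    e₀ := V × h
    eps := totalCrossedModule ρ d hd hb hl
    j₁ := LinearMap.inl 𝕜 W g
    j₀ := LinearMap.inl 𝕜 V h
    π₁ := { LinearMap.snd 𝕜 W g with map_lie' := rfl }
    π₀ := { LinearMap.snd 𝕜 V h with map_lie' := rfl }
    j₁_injective := LinearMap.inl_injective
    j₀_injective := LinearMap.inl_injective
    exact₁ := Function.Exact.inl_snd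
    exact₀ := Function.Exact.inl_snd
    π₁_surjective := Prod.snd_surjective
    π₀_surjective := Prod.snd_surjective
    j₁_lie := fun w w' => by
      refine Prod.ext ?_ (lie_self (0 : g))
      change ρ.onW (M.mu 0) w' - ρ.onW (M.mu 0) w - d.om1 0 0 = 0
      simp
    j₀_lie := fun v v' => by
      refine Prod.ext ?_ (lie_self (0 : h))
      change ρ.onV 0 v' - ρ.onV 0 v - d.om0 0 0 = 0
      simp
    eps_j₁ := fun w => by
      refine Prod.ext ?_ (map_zero M.mu)
      change phi w + d.ph 0 = phi w
      simp
    act_j := fun v w => by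
      refine Prod.ext ?_ (map_zero _)
      change ρ.onW 0 w - ρ.one 0 v - d.al 0 0 = 0
      simp
    π₀_eps := fun _ => rfl
    π₁_act := fun _ _ => rfl }

/-- The canonical splitting of the extension determined by a cocycle. -/
def totalSplitting (ρ : TwoRep M phi) (d : TwoCochain 𝕜 g h W V)
    (hd : d.IsCocycle ρ) (hb : d.bh = 0) (hl : d.lam = 0) :
    (totalExtension ρ d hd hb hl).Splitting where
  σ₁ := LinearMap.inr 𝕜 W g
  σ₀ := LinearMap.inr 𝕜 V h
  π₁_σ₁ _ := rfl
  π₀_σ₀ _ := rfl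

variable (ρ : TwoRep M phi) (d : TwoCochain 𝕜 g h W V)
    (hd : d.IsCocycle ρ) (hb : d.bh = 0) (hl : d.lam = 0)

theorem totalExtension_inducesAlong :
    (totalExtension ρ d hd hb hl).InducesAlong (totalSplitting ρ d hd hb hl) ρ := by
  refine ⟨fun y v => Prod.ext ?_ ?_, fun y w => Prod.ext ?_ ?_, fun x v => Prod.ext ?_ ?_⟩
  · change ρ.onV y v = ρ.onV y v - ρ.onV 0 0 - d.om0 y 0
    simp
  · exact (lie_zero y).symm
  · change ρ.onW y w = ρ.onW y w - ρ.one 0 0 - d.al y 0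
    simp
  · exact (map_zero _).symm
  · change ρ.one x v = -(ρ.onW 0 0 - ρ.one x v - d.al 0 x)
    simp
  · change (0 : g) = -(M.act 0 x)
    simp

theorem totalExtension_hasCochain (hu : d.u = 0) :
    (totalExtension ρ d hd hb hl).HasCochain (totalSplitting ρ d hd hb hl) d := by
  refine ⟨fun y₀ y₁ => Prod.ext ?_ ?_, fun y x => Prod.ext ?_ ?_, fun x => Prod.ext ?_ ?_,
    fun x₀ x₁ => Prod.ext ?_ ?_, hb, hl, hu⟩
  · change d.om0 y₀ y₁ = 0 - (ρ.onV y₀ 0 - ρ.onV y₁ 0 - d.om0 y₀ y₁)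
    simp
  · exact (sub_self ⁅y₀, y₁⁆).symm
  · change d.al y x = 0 - (ρ.onW y 0 - ρ.one x 0 - d.al y x)
    simp
  · exact (sub_self (M.act y x)).symm
  · change d.ph x = phi 0 + d.ph x - 0
    simp
  · exact (sub_self (M.mu x)).symm
  · change d.om1 x₀ x₁ = 0 - (ρ.onW (M.mu x₀) 0 - ρ.onW (M.mu x₁) 0 - d.om1 x₀ x₁)
    simp
  · exact (sub_self ⁅x₀, x₁⁆).symm

end Total
-- Change of splitting and comparison of extensions
section Comparison

variable {𝕜 : Type v} [Field 𝕜] {g h W V : Type u}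
  [LieRing g] [LieAlgebra 𝕜 g] [LieRing h] [LieAlgebra 𝕜 h]
  [AddCommGroup W] [Module 𝕜 W] [AddCommGroup V] [Module 𝕜 V]
  {M : CrossedModule 𝕜 g h} {phi : W →ₗ[𝕜] V}

theorem TwoCochain.toPre_sub_eq {a b c : TwoCochain 𝕜 g h W V}
    (om0 : ∀ y₀ y₁, a.om0 y₀ y₁ - b.om0 y₀ y₁ = c.om0 y₀ y₁)
    (al : ∀ y x, a.al y x - b.al y x = c.al y x) (ph : ∀ x, a.ph x - b.ph x = c.ph x)
    (bh : ∀ y, a.bh y - b.bh y = c.bh y)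
    (om1 : ∀ x₀ x₁, a.om1 x₀ x₁ - b.om1 x₀ x₁ = c.om1 x₀ x₁)
    (lam : ∀ x, a.lam x - b.lam x = c.lam x) (u : a.u - b.u = c.u) :
    a.toPre - b.toPre = c.toPre := by
  refine Prod.ext (funext fun p => funext fun q => ?_)
    (funext fun p => funext fun q => funext fun r => ?_)
  · by_cases hpq : p + q = 2
    · obtain ⟨rfl, rfl⟩ | ⟨rfl, rfl⟩ | ⟨rfl, rfl⟩ :
        (p = 0 ∧ q = 2) ∨ (p = 1 ∧ q = 1) ∨ (p = 2 ∧ q = 0) := by omega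
      · exact funext fun Y => om0 _ _
      · funext Y
        change a.ph _ + a.bh _ - (b.ph _ + b.bh _) = c.ph _ + c.bh _
        rw [← ph, ← bh]
        abel
      · exact funext fun Y => u
    · change a.toPre.1 p q - b.toPre.1 p q = c.toPre.1 p q
      rw [a.toPre_fst_eq_zero p q hpq, b.toPre_fst_eq_zero p q hpq, c.toPre_fst_eq_zero p q hpq,
        sub_zero]
  · by_cases hpq : p + q + (r + 1) = 2
    · obtain ⟨rfl, rfl, rfl⟩ | ⟨rfl, rfl, rfl⟩ | ⟨rfl, rfl, rfl⟩ :
        (p = 0 ∧ q = 1 ∧ r = 0) ∨ (p = 0 ∧ q = 0 ∧ r = 1) ∨ (p = 1 ∧ q = 0 ∧ r = 0) := by omega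
      · exact funext fun Y => funext fun X => al _ _
      · exact funext fun Y => funext fun X => om1 _ _
      · exact funext fun Y => funext fun X => lam _
    · change a.toPre.2 p q r - b.toPre.2 p q r = c.toPre.2 p q r
      rw [a.toPre_snd_eq_zero p q r hpq, b.toPre_snd_eq_zero p q r hpq,
        c.toPre_snd_eq_zero p q r hpq, sub_zero]

theorem TwoCochain.toPre_injective :
    Function.Injective (TwoCochain.toPre : TwoCochain 𝕜 g h W V → _) := by
  intro a b hab
  have hV : ∀ p q Y, a.toPre.1 p q Y = b.toPre.1 p q Y := fun p q Y => by rw [hab]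
  have hW : ∀ p q r Y X, a.toPre.2 p q r Y X = b.toPre.2 p q r Y X :=
    fun p q r Y X => by rw [hab]
  have om0 : a.om0 = b.om0 := by
    ext y₀ y₁; exact hV 0 2 ![(0, y₀), (0, y₁)]
  have al : a.al = b.al := by
    ext y x; exact hW 0 1 0 ![(0, y)] ![x]
  have ph : a.ph = b.ph := by
    ext x; simpa [TwoCochain.toPre] using hV 1 1 ![(![x], 0)]
  have bh : a.bh = b.bh := by
    ext y; simpa [TwoCochain.toPre] using hV 1 1 ![(0, y)]
  have om1 : a.om1 = b.om1 := by
    ext x₀ x₁; exact hW 0 0 1 ![] ![x₀, x₁]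
  have lam : a.lam = b.lam := by
    ext x; exact hW 1 0 0 ![] ![x]
  have u : a.u = b.u := hV 2 0 ![]
  cases a
  cases b
  simp_all

namespace Extension

variable {E F : Extension M phi}

/-- The splitting `σ + j ∘ l`. -/
def Splitting.shift (σ : E.Splitting) (l0 : h →ₗ[𝕜] V) (l1 : g →ₗ[𝕜] W) : E.Splitting where
  σ₁ := σ.σ₁ + E.j₁ ∘ₗ l1
  σ₀ := σ.σ₀ + E.j₀ ∘ₗ l0
  π₁_σ₁ x := by simp [σ.π₁_σ₁, E.π₁_j₁]
  π₀_σ₀ y := by simp [σ.π₀_σ₀, E.π₀_j₀]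

/-- The difference of two sections takes values in `ker π`, the image of `j`. -/
theorem Splitting.exists_eq_shift (σ τ : E.Splitting) :
    ∃ (l0 : h →ₗ[𝕜] V) (l1 : g →ₗ[𝕜] W), τ = σ.shift l0 l1 := by
  obtain ⟨r₁, hr₁⟩ := E.exists_retraction₁
  obtain ⟨r₀, hr₀⟩ := E.exists_retraction₀
  refine ⟨r₀ ∘ₗ (τ.σ₀ - σ.σ₀), r₁ ∘ₗ (τ.σ₁ - σ.σ₁), ?_⟩
  obtain ⟨τ₁, τ₀, h₁, h₀⟩ := τ
  simp only [shift, mk.injEq]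
  refine ⟨LinearMap.ext fun x => ?_, LinearMap.ext fun y => ?_⟩
  · simp only [LinearMap.add_apply, LinearMap.comp_apply]
    rw [hr₁ _ (by simp [h₁, σ.π₁_σ₁])]
    simp
  · simp only [LinearMap.add_apply, LinearMap.comp_apply]
    rw [hr₀ _ (by simp [h₀, σ.π₀_σ₀])]
    simp

/-- In the expansion of the defects of `σ + j ∘ l` the terms quadratic in `l` vanish, because
brackets and action on the kernel are zero; the linear terms form the coboundary. -/
theorem HasCochain.sub_shift {ρ : TwoRep M phi} (hρ : E.ActsBy ρ) {σ : E.Splitting}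
    {l0 : h →ₗ[𝕜] V} {l1 : g →ₗ[𝕜] W} {d d' : TwoCochain 𝕜 g h W V} (hd : E.HasCochain σ d)
    (hd' : E.HasCochain (σ.shift l0 l1) d') :
    d.toPre - d'.toPre = nabla ρ (onePre l0 l1 0) := by
  have hV : ∀ y v, E.j₀ (ρ.onV y v) = ⁅σ.σ₀ y, E.j₀ v⁆ := (hρ.inducesAlong σ).1
  have hW : ∀ y w, E.j₁ (ρ.onW y w) = E.eps.act (σ.σ₀ y) (E.j₁ w) := (hρ.inducesAlong σ).2.1
  have h1 : ∀ x v, E.j₁ (ρ.one x v) = -E.eps.act (E.j₀ v) (σ.σ₁ x) := (hρ.inducesAlong σ).2.2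
  have hWmu : ∀ x w, E.j₁ (ρ.onW (M.mu x) w) = ⁅σ.σ₁ x, E.j₁ w⁆ := fun x w => by
    rw [← E.eps.peiffer, ← hρ.onW, E.π₀_eps, σ.π₁_σ₁]
  rw [nabla_onePre]
  refine TwoCochain.toPre_sub_eq (fun y₀ y₁ => E.j₀_injective ?_)
    (fun y x => E.j₁_injective ?_) (fun x => E.j₀_injective ?_) (fun y => ?_)
    (fun x₀ x₁ => E.j₁_injective ?_) (fun x => ?_) ?_
  · simp only [map_sub, hd.om0, hd'.om0, oneDiff, LinearMap.mk₂_apply, hV, Splitting.shift,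
      LinearMap.add_apply, LinearMap.comp_apply, add_lie, lie_add, E.j₀_lie]
    rw [← lie_skew (E.j₀ (l0 y₀))]
    abel
  · simp only [map_sub, hd.al, hd'.al, oneDiff, LinearMap.mk₂_apply, hW, h1, Splitting.shift,
      LinearMap.add_apply, LinearMap.comp_apply, map_add, LieDerivation.add_apply, E.act_j]
    abel
  · simp only [map_sub, hd.ph, hd'.ph, oneDiff, Splitting.shift, LinearMap.add_apply,
      LinearMap.sub_apply, LinearMap.comp_apply, map_add, map_zero, ← E.eps_j₁,
      LieHom.coe_toLinearMap]
    simp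
    abel
  · simp [hd.bh, hd'.bh, oneDiff]
  · simp only [map_sub, hd.om1, hd'.om1, oneDiff, LinearMap.mk₂_apply, hWmu, Splitting.shift,
      LinearMap.add_apply, LinearMap.comp_apply, add_lie, lie_add, E.j₁_lie]
    rw [← lie_skew (E.j₁ (l1 x₀))]
    abel
  · simp [hd.lam, hd'.lam, oneDiff]
  · simp [hd.u, hd'.u, oneDiff]

/-- The transported splitting `ψ ∘ σ` has the same defects, since `ψ` preserves all the structure
and commutes with `j`. So equivalent extensions have the same class. -/
theorem Equivalent.exists_hasCochain (hEF : E.Equivalent F) {σ : E.Splitting}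
    {d : TwoCochain 𝕜 g h W V} (hd : E.HasCochain σ d) :
    ∃ τ : F.Splitting, F.HasCochain τ d := by
  obtain ⟨ψ₁, ψ₀, h1, h2, h3, h4, h5, h6⟩ := hEF
  refine ⟨⟨(ψ₁ : E.e₁ →ₗ[𝕜] F.e₁) ∘ₗ σ.σ₁, (ψ₀ : E.e₀ →ₗ[𝕜] F.e₀) ∘ₗ σ.σ₀,
    fun x => (h5 _).trans (σ.π₁_σ₁ x), fun y => (h6 _).trans (σ.π₀_σ₀ y)⟩, ?_⟩
  refine ⟨fun y₀ y₁ => ?_, fun y x => ?_, fun x => ?_, fun x₀ x₁ => ?_, hd.bh, hd.lam, hd.u⟩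
  · change _ = ψ₀ _ - ⁅ψ₀ _, ψ₀ _⁆
    rw [← h4, hd.om0, map_sub, LieEquiv.map_lie]
  · change _ = ψ₁ _ - F.eps.act (ψ₀ _) (ψ₁ _)
    rw [← h3, hd.al, map_sub, h2]
  · change _ = F.eps.mu (ψ₁ _) - ψ₀ _
    rw [← h4, hd.ph, map_sub, h1]
  · change _ = ψ₁ _ - ⁅ψ₁ _, ψ₁ _⁆
    rw [← h3, hd.om1, map_sub, LieEquiv.map_lie]

/-- The linear identification of the total space with `W × g` given by a splitting. -/
noncomputable def Splitting.equiv₁ (σ : E.Splitting) : (W × g) ≃ₗ[𝕜] E.e₁ :=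
  LinearEquiv.ofBijective (E.j₁.coprod σ.σ₁) (by
    constructor
    · refine (injective_iff_map_eq_zero _).2 ?_
      rintro ⟨w, x⟩ hwx
      simp only [LinearMap.coprod_apply] at hwx
      have hx : x = 0 := by simpa [E.π₁_j₁, σ.π₁_σ₁] using congrArg E.π₁ hwx
      subst hx
      simp only [map_zero, add_zero] at hwx
      rw [E.j₁_injective (hwx.trans (map_zero _).symm)]
      rfl
    · intro e
      obtain ⟨w, hw⟩ := (E.exact₁ (e - σ.σ₁ (E.π₁ e))).1 (by rw [map_sub, σ.π₁_σ₁, sub_self])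
      exact ⟨(w, E.π₁ e), by simp [hw]⟩)

/-- The linear identification of the total space with `V × h` given by a splitting. -/
noncomputable def Splitting.equiv₀ (σ : E.Splitting) : (V × h) ≃ₗ[𝕜] E.e₀ :=
  LinearEquiv.ofBijective (E.j₀.coprod σ.σ₀) (by
    constructor
    · refine (injective_iff_map_eq_zero _).2 ?_
      rintro ⟨v, y⟩ hvy
      simp only [LinearMap.coprod_apply] at hvy
      have hy : y = 0 := by simpa [E.π₀_j₀, σ.π₀_σ₀] using congrArg E.π₀ hvy
      subst hy
      simp only [map_zero, add_zero] at hvy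
      rw [E.j₀_injective (hvy.trans (map_zero _).symm)]
      rfl
    · intro e
      obtain ⟨v, hv⟩ := (E.exact₀ (e - σ.σ₀ (E.π₀ e))).1 (by rw [map_sub, σ.π₀_σ₀, sub_self])
      exact ⟨(v, E.π₀ e), by simp [hv]⟩)

theorem Splitting.equiv₁_apply (σ : E.Splitting) (a : W × g) :
    σ.equiv₁ a = E.j₁ a.1 + σ.σ₁ a.2 := rfl

theorem Splitting.equiv₀_apply (σ : E.Splitting) (a : V × h) :
    σ.equiv₀ a = E.j₀ a.1 + σ.σ₀ a.2 := rfl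

/-- Here and in the next three lemmas the structure of `E` is read in coordinates. The resulting
expressions involve only `M`, `phi`, `ρ` and `d`. -/
theorem HasCochain.lie₁ {ρ : TwoRep M phi} (hρ : E.ActsBy ρ)
    {σ : E.Splitting} {d : TwoCochain 𝕜 g h W V}
    (hd : E.HasCochain σ d) (a b : W × g) : ⁅σ.equiv₁ a, σ.equiv₁ b⁆ = σ.equiv₁
    (ρ.onW (M.mu a.2) b.1 - ρ.onW (M.mu b.2) a.1 - d.om1 a.2 b.2, ⁅a.2, b.2⁆) := by
  have hWmu : ∀ x w, E.j₁ (ρ.onW (M.mu x) w) = ⁅σ.σ₁ x, E.j₁ w⁆ := fun x w => by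
    rw [← E.eps.peiffer, ← hρ.onW, E.π₀_eps, σ.π₁_σ₁]
  simp only [Splitting.equiv₁_apply, map_sub, hWmu, hd.om1, add_lie, lie_add, E.j₁_lie]
  rw [← lie_skew (E.j₁ a.1)]
  abel

theorem HasCochain.lie₀ {ρ : TwoRep M phi} (hρ : E.ActsBy ρ)
    {σ : E.Splitting} {d : TwoCochain 𝕜 g h W V}
    (hd : E.HasCochain σ d) (a b : V × h) : ⁅σ.equiv₀ a, σ.equiv₀ b⁆ = σ.equiv₀
    (ρ.onV a.2 b.1 - ρ.onV b.2 a.1 - d.om0 a.2 b.2, ⁅a.2, b.2⁆) := by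
  simp only [Splitting.equiv₀_apply, map_sub, (hρ.inducesAlong σ).1, hd.om0, add_lie, lie_add,
    E.j₀_lie]
  rw [← lie_skew (E.j₀ a.1)]
  abel

theorem HasCochain.mu_equiv₁ {σ : E.Splitting} {d : TwoCochain 𝕜 g h W V}
    (hd : E.HasCochain σ d) (a : W × g) :
    E.eps.mu (σ.equiv₁ a) = σ.equiv₀ (phi a.1 + d.ph a.2, M.mu a.2) := by
  simp only [Splitting.equiv₁_apply, Splitting.equiv₀_apply, map_add, hd.ph, E.eps_j₁]
  abel

theorem HasCochain.act_equiv {ρ : TwoRep M phi} (hρ : E.ActsBy ρ)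
    {σ : E.Splitting} {d : TwoCochain 𝕜 g h W V}
    (hd : E.HasCochain σ d) (f : V × h) (a : W × g) :
    E.eps.act (σ.equiv₀ f) (σ.equiv₁ a) =
      σ.equiv₁ (ρ.onW f.2 a.1 - ρ.one a.2 f.1 - d.al f.2 a.2, M.act f.2 a.2) := by
  simp only [Splitting.equiv₁_apply, Splitting.equiv₀_apply, map_add, map_sub, hd.al,
    (hρ.inducesAlong σ).2.1, (hρ.inducesAlong σ).2.2, LieDerivation.add_apply, E.act_j]
  abel

/-- Both extensions have the same structure in the coordinates given by `σ` and `τ`, so passing from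
one set of coordinates to the other is an equivalence. -/
theorem Equivalent.of_hasCochain {ρ : TwoRep M phi} (hE : E.ActsBy ρ) (hF : F.ActsBy ρ)
    {σ : E.Splitting} {τ : F.Splitting} {d : TwoCochain 𝕜 g h W V} (hσ : E.HasCochain σ d)
    (hτ : F.HasCochain τ d) : E.Equivalent F := by
  have k1 : ∀ a, (σ.equiv₁.symm.trans τ.equiv₁) (σ.equiv₁ a) = τ.equiv₁ a := fun a => by simp
  have k0 : ∀ a, (σ.equiv₀.symm.trans τ.equiv₀) (σ.equiv₀ a) = τ.equiv₀ a := fun a => by simp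
  let ψ₁ : E.e₁ ≃ₗ⁅𝕜⁆ F.e₁ :=
    { σ.equiv₁.symm.trans τ.equiv₁ with
      map_lie' := by
        intro a b
        obtain ⟨a, rfl⟩ := σ.equiv₁.surjective a
        obtain ⟨b, rfl⟩ := σ.equiv₁.surjective b
        change (σ.equiv₁.symm.trans τ.equiv₁) _ = ⁅(σ.equiv₁.symm.trans τ.equiv₁) _,
          (σ.equiv₁.symm.trans τ.equiv₁) _⁆
        rw [hσ.lie₁ hE, k1, k1, k1, hτ.lie₁ hF] }
  let ψ₀ : E.e₀ ≃ₗ⁅𝕜⁆ F.e₀ :=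
    { σ.equiv₀.symm.trans τ.equiv₀ with
      map_lie' := by
        intro a b
        obtain ⟨a, rfl⟩ := σ.equiv₀.surjective a
        obtain ⟨b, rfl⟩ := σ.equiv₀.surjective b
        change (σ.equiv₀.symm.trans τ.equiv₀) _ = ⁅(σ.equiv₀.symm.trans τ.equiv₀) _,
          (σ.equiv₀.symm.trans τ.equiv₀) _⁆
        rw [hσ.lie₀ hE, k0, k0, k0, hτ.lie₀ hF] }
  replace k1 : ∀ a, ψ₁ (σ.equiv₁ a) = τ.equiv₁ a := k1
  replace k0 : ∀ a, ψ₀ (σ.equiv₀ a) = τ.equiv₀ a := k0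
  refine ⟨ψ₁, ψ₀, fun e => ?_, fun f e => ?_, fun w => ?_, fun v => ?_, fun e => ?_, fun f => ?_⟩
  · obtain ⟨a, rfl⟩ := σ.equiv₁.surjective e
    rw [hσ.mu_equiv₁, k0, k1, hτ.mu_equiv₁]
  · obtain ⟨a, rfl⟩ := σ.equiv₁.surjective e
    obtain ⟨b, rfl⟩ := σ.equiv₀.surjective f
    rw [hσ.act_equiv hE, k0, k1, k1, hτ.act_equiv hF]
  · simpa [Splitting.equiv₁_apply] using k1 (w, 0)
  · simpa [Splitting.equiv₀_apply] using k0 (v, 0)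
  · obtain ⟨a, rfl⟩ := σ.equiv₁.surjective e
    rw [k1]
    simp [Splitting.equiv₁_apply, E.π₁_j₁, F.π₁_j₁, σ.π₁_σ₁, τ.π₁_σ₁]
  · obtain ⟨a, rfl⟩ := σ.equiv₀.surjective f
    rw [k0]
    simp [Splitting.equiv₀_apply, E.π₀_j₀, F.π₀_j₀, σ.π₀_σ₀, τ.π₀_σ₀]

end Extension
end Comparison

/-! ### Cohomology classes and normalization -/

section Classification

variable {𝕜 : Type v} [Field 𝕜] {g h W V : Type u}
  [LieRing g] [LieAlgebra 𝕜 g] [LieRing h] [LieAlgebra 𝕜 h]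
  [AddCommGroup W] [Module 𝕜 W] [AddCommGroup V] [Module 𝕜 V]
  {M : CrossedModule 𝕜 g h} {phi : W →ₗ[𝕜] V}

theorem TwoCochain.IsCocycle.mem_cocycles {ρ : TwoRep M phi} {d : TwoCochain 𝕜 g h W V}
    (hd : d.IsCocycle ρ) : d.toPre ∈ cocycles ρ 2 :=
  ⟨d.toPre_mem, (nabla_toPre_eq_zero_iff ρ d).2 hd⟩

theorem mk_eq_mk_iff (ρ : TwoRep M phi) (c c' : cocycles ρ 2) :
    (Submodule.Quotient.mk c : Cohomology ρ 2) = Submodule.Quotient.mk c' ↔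
      (c : PreCochain g h W V) - c' ∈ coboundaries ρ 2 := by
  rw [Submodule.Quotient.eq]
  rfl

/-- The cohomology class of an extension. -/
theorem Extension.exists_cohomologyClass {ρ : TwoRep M phi} {E : Extension M phi}
    (hE : E.ActsBy ρ) : ∃ C : Cohomology ρ 2, ∀ (σ : E.Splitting) (d : TwoCochain 𝕜 g h W V)
      (hd : E.HasCochain σ d),
        C = Submodule.Quotient.mk ⟨d.toPre, (hd.isCocycle hE).mem_cocycles⟩ := by
  obtain ⟨σ⟩ := E.nonempty_splitting
  obtain ⟨d, hd⟩ := E.exists_hasCochain σ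
  refine ⟨Submodule.Quotient.mk ⟨d.toPre, (hd.isCocycle hE).mem_cocycles⟩, fun τ d' hd' => ?_⟩
  obtain ⟨l0, l1, rfl⟩ := σ.exists_eq_shift τ
  rw [mk_eq_mk_iff]
  exact ⟨onePre l0 l1 0, onePre_mem l0 l1 0, (hd.sub_shift hE hd').symm⟩

theorem Extension.Induces.actsBy {ρ : TwoRep M phi} {E : Extension M phi} (hE : E.Induces ρ) :
    E.ActsBy ρ :=
  hE.choose_spec.actsBy

/-- Every cocycle is cohomologous to one whose components in tridegrees `(1, 0, 1)` and `(2, 0, 0)`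
vanish and whose component in tridegree `(1, 1, 0)` depends on `g` only. -/
theorem exists_normalized {ρ : TwoRep M phi} {d : TwoCochain 𝕜 g h W V} (hd : d.IsCocycle ρ) :
    ∃ d' : TwoCochain 𝕜 g h W V, d'.IsCocycle ρ ∧ d'.bh = 0 ∧ d'.lam = 0 ∧ d'.u = 0 ∧
      d.toPre - d'.toPre ∈ coboundaries ρ 2 := by
  let d' : TwoCochain 𝕜 g h W V :=
    { d with
      -- The (1,1,0) component of the differential of `u` is `ρ₀⁰(y + mu x)u`: the `y` part equals
      -- `bh`, and the `mu x` part is subtracted from `ph`.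
      ph := d.ph - ρ.onV.flip d.u ∘ₗ (M.mu : g →ₗ[𝕜] h)
      bh := 0
      lam := 0
      u := 0 }
  have hlam : ∀ x, d.lam x = ρ.one x d.u := fun x => (sub_eq_zero.1 (hd.eq201 x)).symm
  have hbh : ∀ y, d.bh y = ρ.onV y d.u := fun y => by
    have h := hd.eq210 0 0 y
    simp only [map_zero, add_zero, zero_add, sub_self, sub_zero] at h
    exact (sub_eq_zero.1 h).symm
  have hsub : d.toPre - d'.toPre = nabla ρ (onePre (0 : h →ₗ[𝕜] V) (0 : g →ₗ[𝕜] W) d.u) := by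
    rw [nabla_onePre]
    refine TwoCochain.toPre_sub_eq ?_ ?_ ?_ ?_ ?_ ?_ ?_ <;>
      simp [d', oneDiff, hlam, hbh]
  have hmem : d.toPre - d'.toPre ∈ coboundaries ρ 2 :=
    ⟨_, onePre_mem 0 0 d.u, hsub.symm⟩
  refine ⟨d', (nabla_toPre_eq_zero_iff ρ d').1 ?_, rfl, rfl, rfl, hmem⟩
  have h : nabla ρ (d.toPre - d'.toPre) = 0 := (coboundaries_two_le_cocycles ρ hmem).2
  rw [map_sub, (nabla_toPre_eq_zero_iff ρ d).2 hd, zero_sub, neg_eq_zero] at h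
  exact h

/-- Cohomologous cochains of splittings become equal after one splitting is shifted, and then
`Equivalent.of_hasCochain` applies. -/
theorem Extension.equivalent_of_sub_mem {ρ : TwoRep M phi} {E F : Extension M phi}
    (hE : E.ActsBy ρ) (hF : F.ActsBy ρ) {σ : E.Splitting} {τ : F.Splitting}
    {d d' : TwoCochain 𝕜 g h W V} (hσ : E.HasCochain σ d) (hτ : F.HasCochain τ d')
    (hdd' : d.toPre - d'.toPre ∈ coboundaries ρ 2) : E.Equivalent F := by
  obtain ⟨c, hc, hcd⟩ := hdd'
  obtain ⟨l0, l1, v, rfl⟩ := exists_onePre_eq hc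
  -- Only differentials with `v = 0` come from a shift of the splitting. The (2,0,0) component of
  -- the differential is `v` itself, and both cochains vanish there.
  have hv : v = 0 := by
    have h : v = d.u - d'.u := by
      have := congrArg (fun c : PreCochain g h W V => c.1 2 0 ![]) hcd
      rwa [nabla_onePre] at this
    rw [h, hσ.u, hτ.u, sub_zero]
  subst hv
  obtain ⟨d'', hd''⟩ := E.exists_hasCochain (σ.shift l0 l1)
  have h := hσ.sub_shift hE hd''
  rw [hcd, sub_right_inj] at h
  rw [TwoCochain.toPre_injective h] at hd''
  exact .of_hasCochain hE hF hd'' hτ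

end Classification
end LieTwo

theorem mainTheorem1 {𝕜 : Type v} [Field 𝕜] {g h W V : Type u}
    [LieRing g] [LieAlgebra 𝕜 g] [LieRing h] [LieAlgebra 𝕜 h]
    [AddCommGroup W] [Module 𝕜 W] [AddCommGroup V] [Module 𝕜 V]
    (M : LieTwo.CrossedModule 𝕜 g h) (phi : W →ₗ[𝕜] V) :
    (∀ E : LieTwo.Extension M phi, ∃ ρ : LieTwo.TwoRep M phi,
      E.Induces ρ ∧ ∀ (σ : E.Splitting) (ρ' : LieTwo.TwoRep M phi),
        E.InducesAlong σ ρ' ↔ ρ' = ρ) ∧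
    ∀ ρ : LieTwo.TwoRep M phi,
      LieTwo.coboundaries ρ 2 ≤ LieTwo.cocycles ρ 2 ∧
      ∃ Φ : LieTwo.ExtensionClass ρ → LieTwo.Cohomology ρ 2,
        Function.Bijective Φ ∧
        ∀ (E : {E : LieTwo.Extension M phi // E.Induces ρ}) (σ : E.1.Splitting),
          ∃ c : LieTwo.cocycles ρ 2, E.1.IsCochainOf σ c.1 ∧
            Φ (LieTwo.ExtensionClass.mk E) = Submodule.Quotient.mk c := by
  refine ⟨fun E => E.exists_unique_induced,
    fun ρ => ⟨LieTwo.coboundaries_two_le_cocycles ρ, ?_⟩⟩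
  choose C hC using fun E : {E : LieTwo.Extension M phi // E.Induces ρ} =>
    LieTwo.Extension.exists_cohomologyClass E.2.actsBy
  refine ⟨Quotient.lift C fun E F hEF => ?_, ⟨?_, ?_⟩, fun E σ => ?_⟩
  · obtain ⟨σ⟩ := E.1.nonempty_splitting
    obtain ⟨d, hd⟩ := E.1.exists_hasCochain σ
    obtain ⟨τ, hτ⟩ := LieTwo.Extension.Equivalent.exists_hasCochain hEF hd
    rw [hC E σ d hd, hC F τ d hτ]
  · rintro ⟨E⟩ ⟨F⟩ hEF
    replace hEF : C E = C F := hEF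
    obtain ⟨σ⟩ := E.1.nonempty_splitting
    obtain ⟨d, hd⟩ := E.1.exists_hasCochain σ
    obtain ⟨τ⟩ := F.1.nonempty_splitting
    obtain ⟨d', hd'⟩ := F.1.exists_hasCochain τ
    rw [hC E σ d hd, hC F τ d' hd', LieTwo.mk_eq_mk_iff] at hEF
    exact Quotient.sound
      (LieTwo.Extension.equivalent_of_sub_mem E.2.actsBy F.2.actsBy hd hd' hEF)
  · intro c
    obtain ⟨⟨c, hc⟩, rfl⟩ := Submodule.Quotient.mk_surjective _ c
    obtain ⟨d, rfl⟩ := LieTwo.exists_toPre_eq hc.1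
    obtain ⟨d', hd', hb, hl, hu, hmem⟩ :=
      LieTwo.exists_normalized ((LieTwo.nabla_toPre_eq_zero_iff ρ d).1 hc.2)
    -- The total extension of the normalized representative has `d'` as the cochain of its canonical
    -- splitting, so its class is that of `d'`, which equals that of `d`.
    refine ⟨LieTwo.ExtensionClass.mk ⟨LieTwo.totalExtension ρ d' hd' hb hl,
      _, LieTwo.totalExtension_inducesAlong ρ d' hd' hb hl⟩, ?_⟩
    refine (hC _ _ d' (LieTwo.totalExtension_hasCochain ρ d' hd' hb hl hu)).trans ?_
    exact ((LieTwo.mk_eq_mk_iff ρ _ _).2 hmem).symm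
  · obtain ⟨d, hd⟩ := E.1.exists_hasCochain σ
    exact ⟨⟨d.toPre, _⟩, hd.isCochainOf, hC E σ d hd⟩
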